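/- Let $\delta=z\,\frac{d}{dz}$ and let $D=\{z\in\mathbb C:|z|<4/27\}$. There is a sequence $A_0,A_1,A_2,\dots$ of holomorphic functions on $D$ such that $A=\sum_{k\ge0}A_k(z)\,a^{-2k}$ is a formal solution (formal power series in $a^{-2}$, with $\delta$ acting on the coefficients) of $$a^2\bigl(z(1+A)^3-A\bigr)=(1+A)\,\delta^2A-(\delta A)^2 .$$ For every such sequence, define the numbers $A_k[n]$ by the Taylor expansion $A_k(z)=(-1)^k\sum_{n}A_k[n]z^n$ at $z=0$. Then for every $k\ge1$ there is a polynomial $R_{3(k-1)}$ with integer coefficients and of degree at most $3(k-1)$ (determined uniquely by the following identity) such that on $D$ $$A_k=-A_0\,\frac{(1+A_0)^{2(k+1)}}{(2A_0-1)^{5k-1}}\,R_{3(k-1)}(A_0),$$ and, with the convention $R_{-3}(\tfrac12):=-(\tfrac23)^2$ for $k=0$, for each fixed $k\ge0$, as $n\to\infty$, $$A_k[n]=\frac{3^{(5-k)/2}}{2^{2k+3}}\,\frac{R_{3(k-1)}(\frac12)}{\Gamma\left(\frac{5k-1}{2}\right)}\,n^{(5k-3)/2}\left(\frac{27}{4}\right)^{n}\bigl(1+o(1)\bigr).$$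 -/

import Mathlib

open Filter Asymptotics Polynomial

noncomputable section

namespace DegenerateP3

/-- The disc `|z| < 2² / 3³`. -/
def disc : Set ℂ := Metric.ball 0 (4 / 27)

/-- The Euler operator `δ_z = z d/dz`. -/
def delta (f : ℂ → ℂ) : ℂ → ℂ := fun z => z * deriv f z

/-- For fixed `z`, the formal series `∑ₖ fₖ(z) ε^k` in the formal variable `ε = a⁻²`. -/
def epsSeries (f : ℕ → ℂ → ℂ) (z : ℂ) : PowerSeries ℂ := PowerSeries.mk fun k => f k z

/-- The functions `A₀, A₁, …` are holomorphic in the disc and `A = ∑ₖ Aₖ(z) a^{-2k}` formally solves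
`a² (z (1 + A)³ - A) = (1 + A) δ²A - (δA)²`.
Both sides are multiplied by `ε = a⁻²`, which is the variable `PowerSeries.X`, and `δ` acts on `A`
coefficientwise. -/
structure IsFormalSolution (A : ℕ → ℂ → ℂ) : Prop where
  holomorphic : ∀ k, DifferentiableOn ℂ (A k) disc
  solves : ∀ z ∈ disc,
    PowerSeries.C z * (1 + epsSeries A z) ^ 3 - epsSeries A z =
      PowerSeries.X *
        ((1 + epsSeries A z) * epsSeries (fun k => delta (delta (A k))) z -
          epsSeries (fun k => delta (A k)) z ^ 2)

/-- `Aₖ[n]`, defined by the Taylor expansion `Aₖ(z) = (-1)^k ∑ₙ Aₖ[n] zⁿ` at `z = 0`. -/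
def taylorCoeff (A : ℕ → ℂ → ℂ) (k n : ℕ) : ℂ :=
  (-1) ^ k * (iteratedDeriv n (A k) 0 / (n.factorial : ℂ))

/-- For `k ≥ 1`: the integer polynomial `R = R_{3(k-1)}` in
`Aₖ = -A₀ (1 + A₀)^{2(k+1)} / (-1 + 2 A₀)^{5k-1} · R(A₀)`.
(The identity alone determines `R`; `2 A₀ ≠ 1` in the disc.) -/
structure IsRPolynomial (A : ℕ → ℂ → ℂ) (k : ℕ) (R : ℤ[X]) : Prop where
  natDegree_le : R.natDegree ≤ 3 * (k - 1)
  eq_on_disc : ∀ z ∈ disc,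
    A k z = -A 0 z * ((1 + A 0 z) ^ (2 * (k + 1)) / (-1 + 2 * A 0 z) ^ (5 * k - 1)) *
      aeval (A 0 z) R

/-- The number `R_{3(k-1)}(1/2)`, with the convention `R_{-3}(1/2) = -(2/3)²` for `k = 0`. -/
def valueAtHalf (R : ℕ → ℤ[X]) (k : ℕ) : ℝ :=
  if k = 0 then -(2 / 3) ^ 2 else aeval (1 / 2 : ℝ) (R k)

/-- `3^{(5-k)/2} / 2^{2k+3} · R_{3(k-1)}(1/2) / Γ((5k-1)/2) · n^{(5k-3)/2} · (3³/2²)ⁿ`. -/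
def mainTerm (R : ℕ → ℤ[X]) (k n : ℕ) : ℝ :=
  (3 : ℝ) ^ ((5 - (k : ℝ)) / 2) / 2 ^ (2 * k + 3) *
    (valueAtHalf R k / Real.Gamma ((5 * (k : ℝ) - 1) / 2)) *
    (n : ℝ) ^ ((5 * (k : ℝ) - 3) / 2) * ((3 : ℝ) ^ 3 / 2 ^ 2) ^ n

end DegenerateP3

end

/-! Put w = A₀. The order-zero part of the equation says z(1+w)³ = w. In the coordinate y = w/(2w-1)
everything becomes polynomial: δy = y(3y-1)(2y-1) and δw = -y(1+w), so δ sends (1+w)P(y) to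
(1+w)(`euler` P)(y). Write 1 + A = (1+w)S(y). After a common factor 2y-1 is cancelled the equation
reads yS³ - (3y-1)S + (2y-1) = ε(3y-1)²(⋯), and the linearisation of the left side at S = 1 is 3y -
(3y-1) = 1. So S = 1 + εu can be solved for by iteration over ℤ[y] without any division; u is
`correction`. Conversely, w determines all later coefficients because 2w ≠ 1 on the disc
(`IsFormalSolution.eq_branchSolution`), so every formal solution has this form.

Three properties of the coefficients uₖ propagate along the recursion: divisibility by
y(3y-1)^(2k+3), degree at most 5k+4, and negativity of the coefficient of y^(5k+4). The first two
leave a cofactor -Q with deg Q ≤ 3k; substituting y = w/(2w-1) and 3y-1 = (1+w)/(2w-1) gives the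
closed form of Aₖ₊₁, with R(x) = (2x-1)^(3k) Q(x/(2x-1)). Then R(1/2) is the coefficient of y^(3k)
in Q divided by 2^(3k), and the third property makes it nonzero, so that the main term is a genuine
equivalent.

The asymptotics need no contour integrals. One has 1 - 3y = ∑ (3n choose n) zⁿ, so Stirling's
formula settles y; a convolution estimate settles y²; and 6y^(j+2) = δ(y^j)/j + 5y^(j+1) - y^j
settles all higher powers, since δ multiplies the n-th Taylor coefficient by n. In (1+w)P(y) the top
power of y dominates. -/

noncomputable section

namespace DegenerateP3

/-! ### Power series agreeing below a given order -/

/-- Two power series have the same coefficients of order `< n`. -/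
def EqBelow {S : Type*} [Semiring S] (n : ℕ) (f g : PowerSeries S) : Prop :=
  ∀ i < n, PowerSeries.coeff i f = PowerSeries.coeff i g

/-- Apply a function to every coefficient of a power series. -/
def coeffwise {S : Type*} [Semiring S] (φ : S → S) (f : PowerSeries S) : PowerSeries S :=
  PowerSeries.mk fun k => φ (PowerSeries.coeff k f)

@[simp] theorem coeff_coeffwise {S : Type*} [Semiring S] (φ : S → S) (f : PowerSeries S) (k : ℕ) :
    PowerSeries.coeff k (coeffwise φ f) = φ (PowerSeries.coeff k f) := by
  simp [coeffwise]

namespace EqBelow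

variable {S : Type*} [CommRing S] {n : ℕ} {f g f' g' : PowerSeries S}

theorem refl (n : ℕ) (f : PowerSeries S) : EqBelow n f f := fun _ _ => rfl

theorem add (h : EqBelow n f g) (h' : EqBelow n f' g') : EqBelow n (f + f') (g + g') :=
  fun i hi => by simp [h i hi, h' i hi]

theorem sub (h : EqBelow n f g) (h' : EqBelow n f' g') : EqBelow n (f - f') (g - g') :=
  fun i hi => by simp [h i hi, h' i hi]

theorem mul (h : EqBelow n f g) (h' : EqBelow n f' g') : EqBelow n (f * f') (g * g') := by
  intro i hi
  rw [PowerSeries.coeff_mul, PowerSeries.coeff_mul]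
  refine Finset.sum_congr rfl fun p hp => ?_
  rw [Finset.HasAntidiagonal.mem_antidiagonal] at hp
  rw [h p.1 (by omega), h' p.2 (by omega)]

theorem pow (h : EqBelow n f g) (m : ℕ) : EqBelow n (f ^ m) (g ^ m) := by
  induction m with
  | zero => simpa using refl n 1
  | succ m ih => simpa [pow_succ] using ih.mul h

theorem coeffwise (φ : S → S) (h : EqBelow n f g) :
    EqBelow n (coeffwise φ f) (coeffwise φ g) :=
  fun i hi => by simp [h i hi]

theorem X_mul (h : EqBelow n f g) :
    EqBelow (n + 1) (PowerSeries.X * f) (PowerSeries.X * g) := by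
  rintro (_ | i) hi
  · simp
  · simp [PowerSeries.coeff_succ_X_mul, h i (by omega)]

theorem mono {m : ℕ} (h : EqBelow n f g) (hm : m ≤ n) : EqBelow m f g :=
  fun i hi => h i (by omega)

end EqBelow

/-! ### The formal recursion over `ℤ[X]` -/

/-- The derivation `X (3X - 1) d/dX` of `ℤ[X]`. -/
def theta (p : ℤ[X]) : ℤ[X] := X * (3 * X - 1) * derivative p

/-- The operator `θ (2X - 1) θ` with `θ = X (3X - 1) d/dX`. -/
def thetaTwo (p : ℤ[X]) : ℤ[X] := theta ((2 * X - 1) * theta p)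

/-- Abbreviation for constant series over `ℤ[X]`. -/
abbrev cst (p : ℤ[X]) : PowerSeries ℤ[X] := PowerSeries.C p

/-- The part of `recursionMap` of first order in `ε`. -/
def linPart (f : PowerSeries ℤ[X]) : PowerSeries ℤ[X] :=
  cst ((3 * X - 1) ^ 2) * (coeffwise thetaTwo f - cst (2 * X * (3 * X - 1)) * f) -
    cst (3 * X) * (f * f)

/-- The part of `recursionMap` of second order in `ε`. -/
def quadPart (f : PowerSeries ℤ[X]) : PowerSeries ℤ[X] :=
  cst ((3 * X - 1) ^ 2) * (f * coeffwise thetaTwo f - cst (X * (3 * X - 1)) * (f * f) -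
    cst (2 * X - 1) * (coeffwise theta f * coeffwise theta f)) - cst X * (f * (f * f))

/-- The map whose fixed point is the formal series `(A - A₀) / (ε (1 + A₀))`, written in the
variable `A₀ / (2 A₀ - 1)`. -/
def recursionMap (f : PowerSeries ℤ[X]) : PowerSeries ℤ[X] :=
  cst (-(X * (3 * X - 1) ^ 3)) + PowerSeries.X * (linPart f + PowerSeries.X * quadPart f)

theorem EqBelow.linPart {n : ℕ} {f g : PowerSeries ℤ[X]} (h : EqBelow n f g) :
    EqBelow n (linPart f) (linPart g) :=
  ((EqBelow.refl _ _).mul ((h.coeffwise _).sub ((EqBelow.refl _ _).mul h))).sub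
    ((EqBelow.refl _ _).mul (h.mul h))

theorem EqBelow.quadPart {n : ℕ} {f g : PowerSeries ℤ[X]} (h : EqBelow n f g) :
    EqBelow n (quadPart f) (quadPart g) :=
  ((EqBelow.refl _ _).mul (((h.mul (h.coeffwise _)).sub ((EqBelow.refl _ _).mul (h.mul h))).sub
    ((EqBelow.refl _ _).mul ((h.coeffwise _).mul (h.coeffwise _))))).sub
      ((EqBelow.refl _ _).mul (h.mul (h.mul h)))

/-- The outer factor `PowerSeries.X` gains one order of agreement, so the map is an `X`-adic
contraction: its iterates from 0 stabilise coefficient by coefficient, and `correction` is their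
limit. -/
theorem EqBelow.recursionMap {n : ℕ} {f g : PowerSeries ℤ[X]} (h : EqBelow n f g) :
    EqBelow (n + 1) (recursionMap f) (recursionMap g) :=
  (EqBelow.refl _ _).add (h.linPart.add (h.quadPart.X_mul.mono (by omega))).X_mul

/-- The fixed point of `recursionMap`. -/
def correction : PowerSeries ℤ[X] :=
  PowerSeries.mk fun k => PowerSeries.coeff k (recursionMap^[k + 1] 0)

theorem iterate_recursionMap_eqBelow (n m : ℕ) (h : n ≤ m) :
    EqBelow n (recursionMap^[m] 0) (recursionMap^[n] 0) := by
  induction n generalizing m with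
  | zero => intro i hi; omega
  | succ n ih =>
    obtain ⟨m, rfl⟩ : ∃ m', m = m' + 1 := ⟨m - 1, by omega⟩
    rw [Function.iterate_succ_apply', Function.iterate_succ_apply']
    exact (ih m (by omega)).recursionMap

theorem correction_eqBelow_iterate (n : ℕ) : EqBelow n correction (recursionMap^[n] 0) := by
  intro i hi
  rw [correction, PowerSeries.coeff_mk]
  exact (iterate_recursionMap_eqBelow (i + 1) n (by omega) i (by omega)).symm

theorem correction_eq : correction = recursionMap correction := by
  ext1 k
  have h := (correction_eqBelow_iterate k).recursionMap k (by omega)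
  rw [h, ← Function.iterate_succ_apply' recursionMap]
  exact correction_eqBelow_iterate (k + 1) k (by omega)

theorem correction_coeff_zero :
    PowerSeries.coeff 0 correction = -(X * (3 * X - 1) ^ 3) := by
  rw [correction_eq, recursionMap]
  simp

theorem correction_coeff_one :
    PowerSeries.coeff 1 correction = PowerSeries.coeff 0 (linPart correction) := by
  conv_lhs => rw [correction_eq, recursionMap]
  rw [map_add, show (1 : ℕ) = 0 + 1 from rfl, PowerSeries.coeff_succ_X_mul, PowerSeries.coeff_C,
    if_neg (by omega)]
  simp

theorem correction_coeff_add_two (k : ℕ) :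
    PowerSeries.coeff (k + 2) correction =
      PowerSeries.coeff (k + 1) (linPart correction) +
        PowerSeries.coeff k (quadPart correction) := by
  conv_lhs => rw [correction_eq, recursionMap]
  rw [map_add, show k + 2 = (k + 1) + 1 from rfl, PowerSeries.coeff_succ_X_mul, map_add,
    PowerSeries.coeff_succ_X_mul, PowerSeries.coeff_C, if_neg (by omega), zero_add]

/-! ### Divisibility of the coefficients -/

/-- The coefficients of order `k < n` are divisible by `(3X - 1) ^ (2k) * p`. -/
def DvdBelow (n : ℕ) (p : ℤ[X]) (f : PowerSeries ℤ[X]) : Prop :=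
  ∀ k < n, (3 * X - 1) ^ (2 * k) * p ∣ PowerSeries.coeff k f

namespace DvdBelow

variable {n : ℕ} {p q : ℤ[X]} {f g : PowerSeries ℤ[X]}

theorem mul (hf : DvdBelow n p f) (hg : DvdBelow n q g) : DvdBelow n (p * q) (f * g) := by
  intro k hk
  rw [PowerSeries.coeff_mul]
  refine Finset.dvd_sum fun i hi => ?_
  rw [Finset.HasAntidiagonal.mem_antidiagonal] at hi
  have h := mul_dvd_mul (hf i.1 (by omega)) (hg i.2 (by omega))
  rwa [show (3 * X - 1 : ℤ[X]) ^ (2 * k) * (p * q) =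
    (3 * X - 1) ^ (2 * i.1) * p * ((3 * X - 1) ^ (2 * i.2) * q) by rw [← hi]; ring]

theorem sub (hf : DvdBelow n p f) (hg : DvdBelow n p g) : DvdBelow n p (f - g) := fun k hk => by
  rw [map_sub]; exact dvd_sub (hf k hk) (hg k hk)

theorem cst_mul (a : ℤ[X]) (hf : DvdBelow n p f) : DvdBelow n (a * p) (cst a * f) := fun k hk => by
  rw [PowerSeries.coeff_C_mul, show (3 * X - 1 : ℤ[X]) ^ (2 * k) * (a * p) =
    a * ((3 * X - 1) ^ (2 * k) * p) by ring]
  exact mul_dvd_mul_left _ (hf k hk)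

theorem weaken (hf : DvdBelow n p f) (h : q ∣ p) : DvdBelow n q f := fun k hk =>
  (mul_dvd_mul_left _ h).trans (hf k hk)

end DvdBelow

/-- Differentiation lowers the order of vanishing at 0 and at 1/3 by at most one, and the prefactor
`X * (3 * X - 1)` of `theta` restores it. -/
theorem dvd_theta {m : ℕ} {p : ℤ[X]} (h : X * (3 * X - 1) ^ m ∣ p) :
    X * (3 * X - 1) ^ m ∣ theta p := by
  obtain ⟨q, rfl⟩ := h
  rcases m with _ | m
  · refine ⟨(3 * X - 1) * derivative (X * q), ?_⟩
    simp [theta]; ring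
  · refine ⟨((3 * X - 1) + 3 * ((m : ℤ[X]) + 1) * X) * q + X * (3 * X - 1) * derivative q, ?_⟩
    simp [theta, derivative_pow]
    ring

theorem dvd_thetaTwo {m : ℕ} {p : ℤ[X]} (h : X * (3 * X - 1) ^ m ∣ p) :
    X * (3 * X - 1) ^ m ∣ thetaTwo p :=
  dvd_theta ((dvd_theta h).mul_left _)

theorem DvdBelow.coeffwise {n : ℕ} {f : PowerSeries ℤ[X]} {φ : ℤ[X] → ℤ[X]}
    (hφ : ∀ (m : ℕ) (p : ℤ[X]), X * (3 * X - 1) ^ m ∣ p → X * (3 * X - 1) ^ m ∣ φ p)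
    {m : ℕ} (h : DvdBelow n (X * (3 * X - 1) ^ m) f) :
    DvdBelow n (X * (3 * X - 1) ^ m) (coeffwise φ f) := by
  intro k hk
  have e : (3 * X - 1 : ℤ[X]) ^ (2 * k) * (X * (3 * X - 1) ^ m) = X * (3 * X - 1) ^ (2 * k + m) := by
    ring
  have := h k hk
  rw [e] at this ⊢
  rw [coeff_coeffwise]
  exact hφ _ _ this

/-- The exponents 5 here and 7 for `quadPart` are 3 + 2 and 3 + 4: these parts enter the recursion
one and two orders higher, and each order must bring a factor `(3 * X - 1) ^ 2`. -/
theorem DvdBelow.linPart {n : ℕ} {f : PowerSeries ℤ[X]}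
    (h : DvdBelow n (X * (3 * X - 1) ^ 3) f) : DvdBelow n (X * (3 * X - 1) ^ 5) (linPart f) := by
  refine .sub (((DvdBelow.sub (p := X * (3 * X - 1) ^ 3) (h.coeffwise fun _ _ => dvd_thetaTwo)
    ((h.cst_mul _).weaken (dvd_mul_left _ _))).cst_mul _).weaken ?_)
    (((h.mul h).cst_mul _).weaken ?_)
  · exact Dvd.intro 1 (by ring)
  · exact Dvd.intro (3 * X ^ 2 * (3 * X - 1)) (by ring)

theorem DvdBelow.quadPart {n : ℕ} {f : PowerSeries ℤ[X]}
    (h : DvdBelow n (X * (3 * X - 1) ^ 3) f) : DvdBelow n (X * (3 * X - 1) ^ 7) (quadPart f) := by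
  have hθ := h.coeffwise fun _ _ => dvd_theta
  have hT := h.coeffwise fun _ _ => dvd_thetaTwo
  refine .sub (((DvdBelow.sub (p := X * (3 * X - 1) ^ 6) (.sub ((h.mul hT).weaken ?_)
    (((h.mul h).cst_mul _).weaken ?_)) (((hθ.mul hθ).cst_mul _).weaken ?_)).cst_mul _).weaken ?_)
    (((h.mul (h.mul h)).cst_mul _).weaken ?_)
  · exact Dvd.intro X (by ring)
  · exact Dvd.intro (X ^ 2 * (3 * X - 1)) (by ring)
  · exact Dvd.intro (X * (2 * X - 1)) (by ring)
  · exact Dvd.intro (3 * X - 1) (by ring)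
  · exact Dvd.intro (X ^ 3 * (3 * X - 1) ^ 2) (by ring)

theorem correction_dvdBelow (n : ℕ) : DvdBelow n (X * (3 * X - 1) ^ 3) correction := by
  induction n with
  | zero => intro k hk; omega
  | succ n ih =>
    intro k hk
    rcases (by omega : k < n ∨ k = n) with hk | rfl
    · exact ih k hk
    rcases k with _ | _ | k
    · rw [correction_coeff_zero]; simp
    · rw [zero_add, correction_coeff_one]
      refine dvd_trans (Dvd.intro 1 ?_) (ih.linPart 0 (by omega)); ring
    · rw [correction_coeff_add_two]
      refine dvd_add (dvd_trans (Dvd.intro 1 ?_) (ih.linPart (k + 1) (by omega)))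
        (dvd_trans (Dvd.intro 1 ?_) (ih.quadPart k (by omega)))
      all_goals ring

/-! ### Degrees and leading coefficients -/

/-- The coefficients of order `k < n` have degree at most `5k + d`. -/
def DegBelow (n d : ℕ) (f : PowerSeries ℤ[X]) : Prop :=
  ∀ k < n, (PowerSeries.coeff k f).natDegree ≤ 5 * k + d

namespace DegBelow

variable {n d e : ℕ} {f g : PowerSeries ℤ[X]}

theorem mul (hf : DegBelow n d f) (hg : DegBelow n e g) : DegBelow n (d + e) (f * g) := by
  intro k hk
  rw [PowerSeries.coeff_mul]
  refine natDegree_sum_le_of_forall_le _ _ fun i hi => ?_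
  rw [Finset.HasAntidiagonal.mem_antidiagonal] at hi
  have := natDegree_mul_le_of_le (hf i.1 (by omega)) (hg i.2 (by omega))
  omega

theorem sub (hf : DegBelow n d f) (hg : DegBelow n d g) : DegBelow n d (f - g) := fun k hk => by
  rw [map_sub]; exact natDegree_sub_le_of_le (hf k hk) (hg k hk) |>.trans (by simp)

theorem cst_mul {a : ℤ[X]} (ha : a.natDegree ≤ e) (hf : DegBelow n d f) :
    DegBelow n (e + d) (cst a * f) := fun k hk => by
  rw [PowerSeries.coeff_C_mul]
  have := natDegree_mul_le_of_le ha (hf k hk)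
  omega

theorem weaken (hf : DegBelow n d f) (h : d ≤ e) : DegBelow n e f := fun k hk =>
  (hf k hk).trans (by omega)

theorem coeffwise {φ : ℤ[X] → ℤ[X]} (hφ : ∀ (m : ℕ) (p : ℤ[X]), p.natDegree ≤ m →
    (φ p).natDegree ≤ m + e) (hf : DegBelow n d f) : DegBelow n (d + e) (coeffwise φ f) :=
  fun k hk => by
    rw [coeff_coeffwise, ← add_assoc]
    exact hφ _ _ (hf k hk)

end DegBelow

theorem coeff_theta_succ (p : ℤ[X]) (m : ℕ) :
    (theta p).coeff (m + 1) = 3 * m * p.coeff m - (m + 1) * p.coeff (m + 1) := by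
  have : theta p = 3 * (X * (X * derivative p)) - X * derivative p := by rw [theta]; ring
  rw [this, coeff_sub, show (3 : ℤ[X]) = C 3 from rfl, coeff_C_mul, coeff_X_mul, coeff_X_mul]
  rcases m with _ | m
  · simp [coeff_derivative]
  · simp [coeff_derivative]; ring

theorem natDegree_theta_le (m : ℕ) (p : ℤ[X]) (h : p.natDegree ≤ m) :
    (theta p).natDegree ≤ m + 1 := by
  rw [natDegree_le_iff_coeff_eq_zero]
  rintro (_ | N) hN
  · omega
  · rw [coeff_theta_succ, coeff_eq_zero_of_natDegree_lt (by omega),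
      coeff_eq_zero_of_natDegree_lt (by omega)]
    simp

theorem natDegree_two_X_sub_one_le : (2 * X - 1 : ℤ[X]).natDegree ≤ 1 := by compute_degree

theorem natDegree_two_X_sub_one_mul_theta_le (m : ℕ) (p : ℤ[X]) (h : p.natDegree ≤ m) :
    ((2 * X - 1) * theta p).natDegree ≤ m + 2 := by
  have := natDegree_mul_le_of_le natDegree_two_X_sub_one_le (natDegree_theta_le m p h)
  omega

theorem natDegree_thetaTwo_le (m : ℕ) (p : ℤ[X]) (h : p.natDegree ≤ m) :
    (thetaTwo p).natDegree ≤ m + 3 :=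
  natDegree_theta_le (m + 2) _ (natDegree_two_X_sub_one_mul_theta_le m p h)

/-- On top-degree terms `theta` acts on degree m as multiplication by 3mX. The factor is therefore
3m, then 2 from `2 * X - 1`, then 3(m+2). -/
theorem coeff_thetaTwo_top (m : ℕ) (p : ℤ[X]) (h : p.natDegree ≤ m) :
    (thetaTwo p).coeff (m + 3) = 18 * m * (m + 2) * p.coeff m := by
  have hθ := natDegree_theta_le m p h
  have h2 := coeff_mul_add_eq_of_natDegree_le natDegree_two_X_sub_one_le hθ
  rw [thetaTwo, show m + 3 = (m + 2) + 1 from rfl, coeff_theta_succ,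
    coeff_eq_zero_of_natDegree_lt (n := m + 2 + 1)
      (by have := natDegree_two_X_sub_one_mul_theta_le m p h; omega),
    show m + 2 = 1 + (m + 1) by ring, h2, coeff_theta_succ,
    coeff_eq_zero_of_natDegree_lt (n := m + 1) (by omega)]
  simp [coeff_one, coeff_ofNat_mul]
  ring

theorem DegBelow.linPart {n : ℕ} {f : PowerSeries ℤ[X]} (h : DegBelow n 4 f) :
    DegBelow n 9 (linPart f) := by
  refine .sub ((DegBelow.cst_mul (e := 2) (by compute_degree) (.sub (d := 7)
    (h.coeffwise natDegree_thetaTwo_le)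
    ((DegBelow.cst_mul (e := 2) (by compute_degree) h).weaken (by omega)))).weaken (by omega))
    (DegBelow.cst_mul (e := 1) (by compute_degree) (h.mul h))

/-- The bound 13 is one less than the 5·2 + 4 that would match the recursion, so the quadratic part
never reaches the top coefficient; only `linPart` does. -/
theorem DegBelow.quadPart {n : ℕ} {f : PowerSeries ℤ[X]} (h : DegBelow n 4 f) :
    DegBelow n 13 (quadPart f) := by
  have hθ := h.coeffwise natDegree_theta_le
  have hT := h.coeffwise natDegree_thetaTwo_le
  refine .sub ((DegBelow.cst_mul (e := 2) (d := 11) (by compute_degree) (.sub (.sub (h.mul hT)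
    ((DegBelow.cst_mul (e := 2) (by compute_degree) (h.mul h)).weaken (by omega)))
    (DegBelow.cst_mul (e := 1) natDegree_two_X_sub_one_le (hθ.mul hθ)))))
    (DegBelow.cst_mul (e := 1) (by compute_degree) (h.mul (h.mul h)))

theorem coeff_linPart_top {k : ℕ} {f : PowerSeries ℤ[X]} (h : DegBelow (k + 1) 4 f) :
    (PowerSeries.coeff k (linPart f)).coeff (5 * k + 9) =
      162 * (5 * k + 4) * (5 * k + 6) * (PowerSeries.coeff k f).coeff (5 * k + 4) -
      3 * ∑ p ∈ Finset.HasAntidiagonal.antidiagonal k, (PowerSeries.coeff p.1 f).coeff (5 * p.1 + 4) *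
        (PowerSeries.coeff p.2 f).coeff (5 * p.2 + 4) := by
  have hb : ((3 * X - 1 : ℤ[X]) ^ 2).natDegree ≤ 2 := by compute_degree
  have hk := h k (by omega)
  have hlow : (2 * X * (3 * X - 1) * PowerSeries.coeff k f).natDegree ≤ 5 * k + 6 := by
    have := natDegree_mul_le_of_le (show (2 * X * (3 * X - 1) : ℤ[X]).natDegree ≤ 2 by
      compute_degree) hk
    omega
  have hT := natDegree_thetaTwo_le _ _ hk
  have hdiff : (thetaTwo (PowerSeries.coeff k f) -
      2 * X * (3 * X - 1) * PowerSeries.coeff k f).natDegree ≤ 5 * k + 4 + 3 :=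
    (natDegree_sub_le_of_le hT hlow).trans (by simp)
  rw [linPart, map_sub, PowerSeries.coeff_C_mul, map_sub, PowerSeries.coeff_C_mul, coeff_coeffwise,
    PowerSeries.coeff_C_mul, coeff_sub, show 5 * k + 9 = 2 + (5 * k + 4 + 3) by ring,
    coeff_mul_add_eq_of_natDegree_le hb hdiff, coeff_sub, coeff_thetaTwo_top _ _ hk,
    coeff_eq_zero_of_natDegree_lt (n := 5 * k + 4 + 3) (by omega),
    show 2 + (5 * k + 4 + 3) = (5 * k + 8) + 1 by ring, show (3 * X : ℤ[X]) = C 3 * X from rfl,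
    mul_assoc (C 3), coeff_C_mul, coeff_X_mul, PowerSeries.coeff_mul, finsetSum_coeff]
  congr 1
  · have : ((3 * X - 1 : ℤ[X]) ^ 2).coeff 2 = 9 := by
      rw [show ((3 * X - 1 : ℤ[X]) ^ 2).coeff 2 = ((3 * X - 1 : ℤ[X]) ^ 2).coeff (2 * 1) from rfl, coeff_pow_of_natDegree_le (by compute_degree)]
      simp [coeff_one, coeff_ofNat_mul]
    rw [show C 3 * X - 1 = (3 * X - 1 : ℤ[X]) from rfl, this]
    push_cast
    ring
  · congr 1
    refine Finset.sum_congr rfl fun p hp => ?_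
    rw [Finset.HasAntidiagonal.mem_antidiagonal] at hp
    rw [← coeff_mul_add_eq_of_natDegree_le (h p.1 (by omega)) (h p.2 (by omega))]
    congr 1
    omega

theorem correction_degBelow (n : ℕ) : DegBelow n 4 correction := by
  induction n with
  | zero => intro k hk; omega
  | succ n ih =>
    intro k hk
    rcases (by omega : k < n ∨ k = n) with hk | rfl
    · exact ih k hk
    rcases k with _ | _ | k
    · rw [correction_coeff_zero, natDegree_neg]
      compute_degree
    · rw [zero_add, correction_coeff_one]
      exact (ih.linPart 0 (by omega)).trans (by omega)
    · rw [correction_coeff_add_two]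
      refine (natDegree_add_le_of_le (ih.linPart (k + 1) (by omega))
        (ih.quadPart k (by omega))).trans ?_
      rw [max_le_iff]; omega

/-- There is no cancellation: the top coefficient is a positive multiple of the previous, negative
one, minus three times a sum of products of two negative numbers. The recursion starts from -27. -/
theorem correction_coeff_top_neg (n : ℕ) :
    (PowerSeries.coeff n correction).coeff (5 * n + 4) < 0 := by
  induction n using Nat.strong_induction_on with
  | _ n ih =>
    have key : ∀ k, k + 1 = n →
        (PowerSeries.coeff k (linPart correction)).coeff (5 * k + 9) < 0 := by
      intro k hk
      rw [coeff_linPart_top (correction_degBelow _)]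
      have h1 := ih k (by omega)
      have h2 : 0 ≤ ∑ p ∈ Finset.HasAntidiagonal.antidiagonal k,
          (PowerSeries.coeff p.1 correction).coeff (5 * p.1 + 4) *
            (PowerSeries.coeff p.2 correction).coeff (5 * p.2 + 4) := by
        refine Finset.sum_nonneg fun p hp => ?_
        rw [Finset.HasAntidiagonal.mem_antidiagonal] at hp
        exact (mul_pos_of_neg_of_neg (ih p.1 (by omega)) (ih p.2 (by omega))).le
      have h3 : (162 * (5 * k + 4) * (5 * k + 6) : ℤ) *
          (PowerSeries.coeff k correction).coeff (5 * k + 4) < 0 :=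
        mul_neg_of_pos_of_neg (by positivity) h1
      linarith
    rcases n with _ | _ | k
    · rw [correction_coeff_zero, coeff_neg, show 5 * 0 + 4 = 3 + 1 by norm_num, coeff_X_mul,
        show ((3 * X - 1 : ℤ[X]) ^ 3).coeff 3 = ((3 * X - 1 : ℤ[X]) ^ 3).coeff (3 * 1) from rfl,
        coeff_pow_of_natDegree_le (by compute_degree)]
      simp [coeff_one, coeff_ofNat_mul]
    · rw [zero_add, correction_coeff_one]
      exact key 0 rfl
    · rw [correction_coeff_add_two, coeff_add,
        coeff_eq_zero_of_natDegree_lt (p := PowerSeries.coeff k (quadPart correction))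
          ((((correction_degBelow (k + 1)).quadPart k (by omega))).trans_lt (by omega)), add_zero]
      exact key (k + 1) rfl

/-! ### Holomorphic branches of `z (1 + w)³ = w` -/

/-- A holomorphic solution `w` of `z (1 + w)³ = w` in the disc. -/
structure IsBranch (w : ℂ → ℂ) : Prop where
  holomorphic : DifferentiableOn ℂ w disc
  eq : ∀ z ∈ disc, z * (1 + w z) ^ 3 = w z

/-- The coordinate `y = w / (2 w - 1)`. -/
def coord (w : ℂ → ℂ) (z : ℂ) : ℂ := w z / (2 * w z - 1)

/-- The function `(1 + w) P(y)` with `y = w / (2 w - 1)`. -/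
def branchTerm (w : ℂ → ℂ) (P : ℤ[X]) (z : ℂ) : ℂ := (1 + w z) * aeval (coord w z) P

/-- The action of `δ` on the factor `P` of `(1 + w) P(y)`. -/
def euler (P : ℤ[X]) : ℤ[X] := (2 * X - 1) * theta P - X * P

theorem isOpen_disc : IsOpen disc := Metric.isOpen_ball

theorem zero_mem_disc : (0 : ℂ) ∈ disc := by simp [disc]

theorem delta_congr {f g : ℂ → ℂ} (h : ∀ z ∈ disc, f z = g z) {z : ℂ} (hz : z ∈ disc) :
    delta f z = delta g z := by
  have : f =ᶠ[nhds z] g := eventually_of_mem (isOpen_disc.mem_nhds hz) h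
  rw [delta, delta, this.deriv_eq]

theorem one_add_ne_zero_of_eq {z w : ℂ} (h : z * (1 + w) ^ 3 = w) : 1 + w ≠ 0 := by
  intro h1
  rw [h1] at h
  have h2 : w = 0 := by rw [← h]; ring
  rw [h2] at h1
  norm_num at h1

/-- The critical point w = 1/2 of w/(1+w)³ has value 4/27, which lies on the boundary of the disc.
-/
theorem two_mul_sub_one_ne_zero_of_eq {z w : ℂ} (hz : z ∈ disc) (h : z * (1 + w) ^ 3 = w) :
    2 * w - 1 ≠ 0 := by
  intro h1
  have h2 : w = 1 / 2 := by linear_combination h1 / 2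
  rw [h2] at h
  have h3 : z = 4 / 27 := by linear_combination (8 / 27) * h
  rw [h3] at hz
  simp [disc] at hz

namespace IsBranch

variable {w : ℂ → ℂ} (hw : IsBranch w) {z : ℂ} (hz : z ∈ disc)

include hw hz

theorem one_add_ne_zero : 1 + w z ≠ 0 := one_add_ne_zero_of_eq (hw.eq z hz)

theorem two_mul_sub_one_ne_zero : 2 * w z - 1 ≠ 0 := two_mul_sub_one_ne_zero_of_eq hz (hw.eq z hz)

theorem coord_mul : coord w z * (2 * w z - 1) = w z :=
  div_mul_cancel₀ _ (hw.two_mul_sub_one_ne_zero hz)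

theorem two_mul_coord_sub_one : (2 * coord w z - 1) * (2 * w z - 1) = 1 := by
  linear_combination 2 * hw.coord_mul hz

theorem two_mul_coord_sub_one_ne_zero : 2 * coord w z - 1 ≠ 0 :=
  left_ne_zero_of_mul_eq_one (hw.two_mul_coord_sub_one hz)

theorem one_add_mul : (1 + w z) * (2 * coord w z - 1) = 3 * coord w z - 1 := by
  linear_combination hw.coord_mul hz

theorem hasDerivAt : HasDerivAt w (deriv w z) z :=
  ((hw.holomorphic z hz).differentiableAt (isOpen_disc.mem_nhds hz)).hasDerivAt

/-- Implicit differentiation of z(1+w)³ = w. The factor (2w-1)(1+w) is cancelled at the end. -/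
theorem deriv_relation : z * deriv w z = -(coord w z) * (1 + w z) := by
  have h1 : HasDerivAt (fun x => x * (1 + w x) ^ 3)
      (1 * (1 + w z) ^ 3 + z * (↑(3 : ℕ) * (1 + w z) ^ (3 - 1) * deriv w z)) z :=
    (hasDerivAt_id z).mul (((hw.hasDerivAt hz).const_add 1).pow 3)
  have h2 : (fun x => x * (1 + w x) ^ 3) =ᶠ[nhds z] w :=
    eventually_of_mem (isOpen_disc.mem_nhds hz) hw.eq
  have h3 := h1.unique ((hw.hasDerivAt hz).congr_of_eventuallyEq h2)
  norm_num at h3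
  have h4 := hw.eq z hz
  have h5 := hw.coord_mul hz
  have h6 := hw.two_mul_sub_one_ne_zero hz
  apply mul_right_cancel₀ (mul_ne_zero h6 (hw.one_add_ne_zero hz))
  linear_combination (z * (1 + w z) ^ 2) * h3 + (1 + w z) ^ 2 * h5 +
    (-(1 + w z) ^ 2 - 3 * (z * deriv w z) * (1 + w z)) * h4

theorem hasDerivAt_coord :
    HasDerivAt (coord w) (-(deriv w z) * (2 * coord w z - 1) ^ 2) z := by
  have h6 := hw.two_mul_sub_one_ne_zero hz
  have h := (hw.hasDerivAt hz).div (((hw.hasDerivAt hz).const_mul 2).sub_const 1) h6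
  refine h.congr_deriv ?_
  have h7 := hw.two_mul_coord_sub_one hz
  rw [div_eq_iff (pow_ne_zero 2 h6)]
  linear_combination (deriv w z) * ((2 * coord w z - 1) * (2 * w z - 1) + 1) * h7

theorem mul_deriv_coord :
    z * deriv (coord w) z = coord w z * (3 * coord w z - 1) * (2 * coord w z - 1) := by
  rw [(hw.hasDerivAt_coord hz).deriv]
  linear_combination (-(2 * coord w z - 1) ^ 2) * hw.deriv_relation hz +
    coord w z * (2 * coord w z - 1) * hw.one_add_mul hz

theorem hasDerivAt_aeval_coord (P : ℤ[X]) :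
    HasDerivAt (fun x => aeval (coord w x) P)
      (aeval (coord w z) (derivative P) * deriv (coord w) z) z := by
  have := (P.hasDerivAt_aeval (coord w z)).comp z
    (hw.hasDerivAt_coord hz).differentiableAt.hasDerivAt
  exact this

theorem delta_aeval_coord (P : ℤ[X]) :
    delta (fun x => aeval (coord w x) P) z = aeval (coord w z) ((2 * X - 1) * theta P) := by
  rw [delta, (hw.hasDerivAt_aeval_coord hz P).deriv]
  simp only [theta, map_mul, map_sub, aeval_X, map_ofNat, map_one]
  linear_combination (aeval (coord w z) (derivative P)) * hw.mul_deriv_coord hz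

theorem hasDerivAt_branchTerm (P : ℤ[X]) : HasDerivAt (branchTerm w P)
    (deriv w z * aeval (coord w z) P +
      (1 + w z) * (aeval (coord w z) (derivative P) * deriv (coord w) z)) z :=
  ((hw.hasDerivAt hz).const_add 1).mul (hw.hasDerivAt_aeval_coord hz P)

theorem delta_branchTerm (P : ℤ[X]) :
    delta (branchTerm w P) z = branchTerm w (euler P) z := by
  rw [delta, (hw.hasDerivAt_branchTerm hz P).deriv]
  simp only [branchTerm, euler, theta, map_mul, map_sub, aeval_X, map_ofNat, map_one]
  linear_combination (aeval (coord w z) P) * hw.deriv_relation hz +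
    (1 + w z) * (aeval (coord w z) (derivative P)) * hw.mul_deriv_coord hz

theorem delta_delta_branchTerm (P : ℤ[X]) :
    delta (delta (branchTerm w P)) z = branchTerm w (euler (euler P)) z := by
  rw [delta_congr (fun x hx => hw.delta_branchTerm hx P) hz, hw.delta_branchTerm hz]

end IsBranch

/-! ### The formal solution attached to a branch -/

/-- The series `(1 + A) / (1 + A₀)` in the variable `A₀ / (2 A₀ - 1)`. -/
def solSeries : PowerSeries ℤ[X] := 1 + PowerSeries.X * correction

/-- The formal solution with `A₀ = w`. -/
def branchSolution (w : ℂ → ℂ) (k : ℕ) (z : ℂ) : ℂ :=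
  branchTerm w (PowerSeries.coeff k solSeries) z - if k = 0 then 1 else 0

theorem branchSolution_zero (w : ℂ → ℂ) : branchSolution w 0 = w := by
  ext z
  simp [branchSolution, branchTerm, solSeries]

theorem branchSolution_succ (w : ℂ → ℂ) (k : ℕ) :
    branchSolution w (k + 1) = branchTerm w (PowerSeries.coeff k correction) := by
  ext z
  simp [branchSolution, solSeries, PowerSeries.coeff_succ_X_mul, PowerSeries.coeff_one]

theorem theta_zero : theta 0 = 0 := by simp [theta]

theorem theta_one : theta 1 = 0 := by simp [theta]

theorem thetaTwo_one : thetaTwo 1 = 0 := by simp [thetaTwo, theta_one, theta_zero]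

theorem coeffwise_solSeries {φ : ℤ[X] → ℤ[X]} (h1 : φ 1 = 0) :
    coeffwise φ solSeries = PowerSeries.X * coeffwise φ correction := by
  ext1 k
  rcases k with _ | k
  · simp [solSeries, h1]
  · simp [solSeries, PowerSeries.coeff_succ_X_mul, PowerSeries.coeff_one]

/-- This is the fixed-point equation of `correction`, multiplied by ε and with S = 1 + εu put back.
Both `theta` and `thetaTwo` kill the constant 1, so the differentiated series carry a factor ε. -/
theorem solSeries_equation :
    cst X * solSeries ^ 3 - cst (3 * X - 1) * solSeries + cst (2 * X - 1) =
      PowerSeries.X * cst ((3 * X - 1) ^ 2) *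
        (solSeries * coeffwise thetaTwo solSeries - cst (X * (3 * X - 1)) * solSeries ^ 2 -
          cst (2 * X - 1) * coeffwise theta solSeries ^ 2) := by
  rw [coeffwise_solSeries theta_one, coeffwise_solSeries thetaTwo_one,
    solSeries]
  have h := correction_eq
  simp only [recursionMap, linPart, quadPart, cst, map_mul, map_sub, map_pow, map_ofNat, map_one,
    map_neg] at h ⊢
  linear_combination PowerSeries.X * h

theorem euler_euler_eq (P : ℤ[X]) : euler (euler P) =
    (2 * X - 1) * (thetaTwo P - X * (3 * X - 1) * P - 2 * X * theta P) + X ^ 2 * P := by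
  simp only [euler, thetaTwo, theta, derivative_mul, derivative_sub, derivative_X, derivative_one,
    derivative_ofNat]
  ring

theorem coeffwise_euler (f : PowerSeries ℤ[X]) :
    coeffwise euler f = cst (2 * X - 1) * coeffwise theta f - cst X * f := by
  ext1 k
  rw [map_sub, PowerSeries.coeff_C_mul, PowerSeries.coeff_C_mul, coeff_coeffwise, coeff_coeffwise,
    euler]

theorem coeffwise_euler_euler (f : PowerSeries ℤ[X]) :
    coeffwise (fun P => euler (euler P)) f = cst (2 * X - 1) * (coeffwise thetaTwo f -
      cst (X * (3 * X - 1)) * f - cst (2 * X) * coeffwise theta f) + cst (X ^ 2) * f := by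
  ext1 k
  rw [coeff_coeffwise, euler_euler_eq, map_add, PowerSeries.coeff_C_mul, PowerSeries.coeff_C_mul,
    map_sub, map_sub, PowerSeries.coeff_C_mul, PowerSeries.coeff_C_mul, coeff_coeffwise,
    coeff_coeffwise]

/-- Modulo 2X - 1 the operator `euler` is multiplication by -X and its square is multiplication by
X². Hence S·E²S - (ES)² is divisible by 2X - 1, which is the factor absent from
`solSeries_equation`. -/
theorem solSeries_equation_mul :
    cst (2 * X - 1) * (cst X * solSeries ^ 3 - cst (3 * X - 1) * solSeries + cst (2 * X - 1)) =
      PowerSeries.X * cst ((3 * X - 1) ^ 2) *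
        (solSeries * coeffwise (fun P => euler (euler P)) solSeries -
          coeffwise euler solSeries ^ 2) := by
  rw [solSeries_equation, coeffwise_euler, coeffwise_euler_euler]
  simp only [cst, map_mul, map_sub, map_pow, map_ofNat, map_one]
  ring

theorem epsSeries_branchTerm (w : ℂ → ℂ) (z : ℂ) (f : PowerSeries ℤ[X]) :
    epsSeries (fun k => branchTerm w (PowerSeries.coeff k f)) z =
      PowerSeries.C (1 + w z) *
        PowerSeries.map ((aeval (coord w z) : ℤ[X] →ₐ[ℤ] ℂ) : ℤ[X] →+* ℂ) f := by
  ext1 k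
  rw [PowerSeries.coeff_C_mul]
  simp [epsSeries, branchTerm]

theorem epsSeries_congr {f g : ℕ → ℂ → ℂ} {z : ℂ} (h : ∀ k, f k z = g k z) :
    epsSeries f z = epsSeries g z := by
  ext1 k
  simp [epsSeries, h k]

theorem delta_sub_const (f : ℂ → ℂ) (c : ℂ) : delta (fun z => f z - c) = delta f := by
  ext z
  simp [delta]

theorem delta_branchSolution (w : ℂ → ℂ) (k : ℕ) :
    delta (branchSolution w k) = delta (branchTerm w (PowerSeries.coeff k solSeries)) :=
  delta_sub_const _ _

theorem IsBranch.isFormalSolution {w : ℂ → ℂ} (hw : IsBranch w) :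
    IsFormalSolution (branchSolution w) where
  holomorphic k z hz :=
    ((hw.hasDerivAt_branchTerm hz _).differentiableAt.sub_const _).differentiableWithinAt
  solves z hz := by
    set φ : ℤ[X] →+* ℂ := ((aeval (coord w z) : ℤ[X] →ₐ[ℤ] ℂ) : ℤ[X] →+* ℂ) with hφ
    have e0 : 1 + epsSeries (branchSolution w) z =
        PowerSeries.C (1 + w z) * PowerSeries.map φ solSeries := by
      rw [hφ, ← epsSeries_branchTerm]
      ext1 k
      simp [epsSeries, branchSolution, PowerSeries.coeff_one]
    have e1 : epsSeries (fun k => delta (branchSolution w k)) z =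
        PowerSeries.C (1 + w z) * PowerSeries.map φ (coeffwise euler solSeries) := by
      rw [hφ, ← epsSeries_branchTerm]
      refine epsSeries_congr fun k => ?_
      rw [delta_branchSolution, hw.delta_branchTerm hz, coeff_coeffwise]
    have e2 : epsSeries (fun k => delta (delta (branchSolution w k))) z =
        PowerSeries.C (1 + w z) *
          PowerSeries.map φ (coeffwise (fun P => euler (euler P)) solSeries) := by
      rw [hφ, ← epsSeries_branchTerm]
      refine epsSeries_congr fun k => ?_
      rw [delta_branchSolution, hw.delta_delta_branchTerm hz, coeff_coeffwise]
    have e3 : epsSeries (branchSolution w) z =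
        PowerSeries.C (1 + w z) * PowerSeries.map φ solSeries - 1 := by
      rw [← e0]; ring
    rw [e0, e1, e2, e3]
    have key := congrArg (PowerSeries.map φ) solSeries_equation_mul
    set g := PowerSeries.map φ solSeries
    set g1 := PowerSeries.map φ (coeffwise euler solSeries)
    set g2 := PowerSeries.map φ (coeffwise (fun P => euler (euler P)) solSeries)
    have hX : φ X = coord w z := by simp [hφ]
    simp only [map_mul, map_sub, map_add, map_pow, PowerSeries.map_X, cst, PowerSeries.map_C,
      hX, map_ofNat, map_one] at key
    have hne : PowerSeries.C (2 * coord w z - 1) ≠ 0 := by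
      rw [Ne, map_eq_zero_iff _ PowerSeries.C_injective]
      exact hw.two_mul_coord_sub_one_ne_zero hz
    have r1 := congrArg PowerSeries.C (hw.one_add_mul hz)
    have r2 := congrArg PowerSeries.C (hw.eq z hz)
    simp only [map_mul, map_sub, map_add, map_pow, map_ofNat, map_one] at r1 r2 hne ⊢
    -- After multiplication by (2y-1)², the relations (1+w)(2y-1) = 3y-1 and z(1+w)³ = w reduce the
    -- equation to `key`.
    apply mul_left_cancel₀ (pow_ne_zero 2 hne)
    generalize PowerSeries.C (coord w z) = Y at *
    generalize PowerSeries.C (w z) = W at *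
    generalize PowerSeries.C z = Z at *
    linear_combination key + (2 * Y - 1) ^ 2 * g ^ 3 * r2 + (2 * Y - 1) * (g ^ 3 - g) * r1 -
      PowerSeries.X * (g * g2 - g1 ^ 2) * ((1 + W) * (2 * Y - 1) + (3 * Y - 1)) * r1

/-- A formal solution is determined by its leading term. -/
theorem IsFormalSolution.eq_branchSolution {A : ℕ → ℂ → ℂ} (hA : IsFormalSolution A)
    (hw : IsBranch (A 0)) (k : ℕ) : ∀ z ∈ disc, A k z = branchSolution (A 0) k z := by
  induction k using Nat.strong_induction_on with
  | _ k ih =>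
    intro z hz
    rcases Nat.eq_zero_or_pos k with rfl | hk
    · rw [branchSolution_zero]
    have h1 := hA.solves z hz
    have h2 := hw.isFormalSolution.solves z hz
    set B := branchSolution (A 0)
    have c0 : EqBelow k (epsSeries A z) (epsSeries B z) := fun i hi => by
      simpa [epsSeries] using ih i hi z hz
    have c1 : EqBelow k (epsSeries (fun k => delta (A k)) z)
        (epsSeries (fun k => delta (B k)) z) := fun i hi => by
      simpa [epsSeries] using delta_congr (ih i hi) hz
    have c2 : EqBelow k (epsSeries (fun k => delta (delta (A k))) z)
        (epsSeries (fun k => delta (delta (B k))) z) := fun i hi => by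
      simpa [epsSeries] using delta_congr (fun x hx => delta_congr (ih i hi) hx) hz
    -- The factor ε shifts orders by one, so agreement below order k makes the right-hand sides
    -- agree at order k itself.
    have rhs := ((((EqBelow.refl k 1).add c0).mul c2).sub (c1.pow 2)).X_mul k (by omega)
    rw [← h1, ← h2] at rhs
    set a := epsSeries A z
    set b := epsSeries B z
    obtain ⟨d, hd⟩ : PowerSeries.X ^ k ∣ a - b := by
      rw [PowerSeries.X_pow_dvd_iff]
      intro m hm
      simp [c0 m hm]
    have hfac : PowerSeries.C z * (1 + a) ^ 3 - a - (PowerSeries.C z * (1 + b) ^ 3 - b) =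
        PowerSeries.X ^ k * (d *
          (PowerSeries.C z * ((1 + a) ^ 2 + (1 + a) * (1 + b) + (1 + b) ^ 2) - 1)) := by
      linear_combination
        (PowerSeries.C z * ((1 + a) ^ 2 + (1 + a) * (1 + b) + (1 + b) ^ 2) - 1) * hd
    have h3 := congrArg (PowerSeries.coeff k) hfac
    rw [map_sub, rhs, sub_self, PowerSeries.coeff_X_pow_mul', if_pos le_rfl, Nat.sub_self] at h3
    have ha0 : PowerSeries.constantCoeff a = A 0 z := by
      simp [a, epsSeries, ← PowerSeries.coeff_zero_eq_constantCoeff_apply]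
    have hb0 : PowerSeries.constantCoeff b = A 0 z := by
      simp [b, B, epsSeries, ← PowerSeries.coeff_zero_eq_constantCoeff_apply, branchSolution_zero]
    simp only [PowerSeries.coeff_zero_eq_constantCoeff_apply, map_mul, map_sub, map_add, map_pow,
      map_one, PowerSeries.constantCoeff_C, ha0, hb0] at h3
    -- This is the linearisation 3z(1+w)² - 1 of the left-hand side; times 1+w it equals 2w-1.
    have hne : z * ((1 + A 0 z) ^ 2 + (1 + A 0 z) * (1 + A 0 z) + (1 + A 0 z) ^ 2) - 1 ≠ 0 := by
      intro h
      apply hw.two_mul_sub_one_ne_zero hz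
      linear_combination (1 + A 0 z) * h - 3 * hw.eq z hz
    have hd0 : PowerSeries.constantCoeff d = 0 :=
      (mul_eq_zero.mp h3.symm).resolve_right hne
    have h4 := congrArg (PowerSeries.coeff k) hd
    rw [PowerSeries.coeff_X_pow_mul', if_pos le_rfl, Nat.sub_self,
      PowerSeries.coeff_zero_eq_constantCoeff_apply, hd0, map_sub, sub_eq_zero] at h4
    simpa [a, b, epsSeries] using h4

theorem IsFormalSolution.isBranch {A : ℕ → ℂ → ℂ} (hA : IsFormalSolution A) :
    IsBranch (A 0) where
  holomorphic := hA.holomorphic 0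
  eq z hz := by
    have h := congrArg PowerSeries.constantCoeff (hA.solves z hz)
    have ha0 : PowerSeries.constantCoeff (epsSeries A z) = A 0 z := by
      simp [epsSeries, ← PowerSeries.coeff_zero_eq_constantCoeff_apply]
    simpa [ha0, sub_eq_zero] using h

/-! ### Existence of a branch -/

theorem norm_one_add_le {w : ℂ} (hw : ‖w‖ ≤ 1 / 2) : ‖1 + w‖ ≤ 3 / 2 := by
  have := norm_add_le 1 w
  rw [norm_one] at this
  linarith

theorem norm_cube_sub_cube_le {v w : ℂ} (hv : ‖v‖ ≤ 1 / 2) (hw : ‖w‖ ≤ 1 / 2) :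
    ‖(1 + w) ^ 3 - (1 + v) ^ 3‖ ≤ 27 / 4 * ‖w - v‖ := by
  have e : (1 + w) ^ 3 - (1 + v) ^ 3 =
      ((1 + w) ^ 2 + (1 + w) * (1 + v) + (1 + v) ^ 2) * (w - v) := by ring
  have h1 := norm_one_add_le hv
  have h2 := norm_one_add_le hw
  rw [e, norm_mul]
  refine mul_le_mul_of_nonneg_right ?_ (norm_nonneg _)
  calc ‖(1 + w) ^ 2 + (1 + w) * (1 + v) + (1 + v) ^ 2‖
      ≤ ‖1 + w‖ ^ 2 + ‖1 + w‖ * ‖1 + v‖ + ‖1 + v‖ ^ 2 := by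
        refine (norm_add₃_le).trans ?_
        simp only [norm_pow, norm_mul, le_refl]
    _ ≤ (3 / 2) ^ 2 + 3 / 2 * (3 / 2) + (3 / 2) ^ 2 := by gcongr
    _ = 27 / 4 := by norm_num

/-- Banach's fixed-point theorem on |w| ≤ 1/2: there w ↦ z(1+w)³ has Lipschitz constant (27/4)|z| <
1, and (4/27)(3/2)³ = 1/2 keeps the ball invariant. -/
theorem exists_fixed_point {z : ℂ} (hz : z ∈ disc) :
    ∃ w : ℂ, ‖w‖ ≤ 1 / 2 ∧ z * (1 + w) ^ 3 = w := by
  have hz' : ‖z‖ < 4 / 27 := by simpa [disc] using hz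
  have hmaps : Set.MapsTo (fun w : ℂ => z * (1 + w) ^ 3) (Metric.closedBall 0 (1 / 2))
      (Metric.closedBall 0 (1 / 2)) := by
    intro w hw
    rw [mem_closedBall_zero_iff] at hw ⊢
    rw [norm_mul, norm_pow]
    calc ‖z‖ * ‖1 + w‖ ^ 3 ≤ 4 / 27 * (3 / 2) ^ 3 := by
          gcongr
          exact norm_one_add_le hw
      _ = 1 / 2 := by norm_num
  have hcontr : ContractingWith (Real.toNNReal (27 / 4 * ‖z‖)) (hmaps.restrict _ _ _) := by
    refine ⟨by rw [Real.toNNReal_lt_one]; linarith, LipschitzWith.of_dist_le_mul ?_⟩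
    rintro ⟨w, hw⟩ ⟨v, hv⟩
    rw [mem_closedBall_zero_iff] at hw hv
    rw [Real.coe_toNNReal _ (by positivity), Subtype.dist_eq, Subtype.dist_eq, dist_eq_norm,
      dist_eq_norm]
    simp only [Set.MapsTo.val_restrict_apply]
    rw [← mul_sub, norm_mul]
    calc ‖z‖ * ‖(1 + w) ^ 3 - (1 + v) ^ 3‖ ≤ ‖z‖ * (27 / 4 * ‖w - v‖) := by
          gcongr
          exact norm_cube_sub_cube_le hv hw
      _ = 27 / 4 * ‖z‖ * ‖w - v‖ := by ring
  obtain ⟨w, hw, hfix, -⟩ := hcontr.exists_fixedPoint' (x := 0)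
    Metric.isClosed_closedBall.isComplete hmaps (by simp) (edist_ne_top _ _)
  exact ⟨w, by simpa using hw, hfix⟩

theorem exists_isBranch : ∃ w : ℂ → ℂ, IsBranch w := by
  choose! w hw using fun (z : ℂ) (hz : z ∈ disc) => exists_fixed_point hz
  refine ⟨w, fun z₀ hz₀ => ?_, fun z hz => (hw z hz).2⟩
  have hz₀' : ‖z₀‖ < 4 / 27 := by simpa [disc] using hz₀
  have hd : disc ∈ nhds z₀ := isOpen_disc.mem_nhds hz₀
  have hc : 0 < 1 - 27 / 4 * ‖z₀‖ := by linarith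
  -- The values of w were chosen point by point; the contraction estimate makes the choice
  -- continuous.
  have hlip : ∀ z ∈ disc, ‖w z - w z₀‖ ≤ 27 / 8 / (1 - 27 / 4 * ‖z₀‖) * ‖z - z₀‖ := by
    intro z hz
    obtain ⟨h1, h2⟩ := hw z hz
    obtain ⟨h3, h4⟩ := hw z₀ hz₀
    have e : w z - w z₀ = (z - z₀) * (1 + w z) ^ 3 + z₀ * ((1 + w z) ^ 3 - (1 + w z₀) ^ 3) := by
      linear_combination h4 - h2
    have h5 : ‖w z - w z₀‖ ≤ ‖z - z₀‖ * (27 / 8) + ‖z₀‖ * (27 / 4 * ‖w z - w z₀‖) := by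
      conv_lhs => rw [e]
      refine (norm_add_le _ _).trans ?_
      rw [norm_mul, norm_mul, norm_pow]
      gcongr
      · calc ‖1 + w z‖ ^ 3 ≤ (3 / 2) ^ 3 := by gcongr; exact norm_one_add_le h1
          _ = 27 / 8 := by norm_num
      · exact norm_cube_sub_cube_le h3 h1
    rw [div_mul_eq_mul_div, le_div_iff₀ hc]
    linarith
  have hcont : ContinuousAt w z₀ := by
    rw [ContinuousAt, tendsto_iff_norm_sub_tendsto_zero]
    refine squeeze_zero' (Eventually.of_forall fun _ => norm_nonneg _)
      (eventually_of_mem hd hlip) ?_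
    have : Tendsto (fun z => 27 / 8 / (1 - 27 / 4 * ‖z₀‖) * ‖z - z₀‖) (nhds z₀)
        (nhds (27 / 8 / (1 - 27 / 4 * ‖z₀‖) * ‖z₀ - z₀‖)) :=
      Continuous.tendsto (by fun_prop) z₀
    simpa using this
  have hne := one_add_ne_zero_of_eq (hw z₀ hz₀).2
  have hne' := two_mul_sub_one_ne_zero_of_eq hz₀ (hw z₀ hz₀).2
  have hder : HasDerivAt (fun v : ℂ => v / (1 + v) ^ 3)
      ((1 * (1 + w z₀) ^ 3 - w z₀ * (↑(3 : ℕ) * (1 + w z₀) ^ (3 - 1) * 1)) /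
        ((1 + w z₀) ^ 3) ^ 2) (w z₀) :=
    (hasDerivAt_id _).div (((hasDerivAt_id _).const_add 1).pow 3) (pow_ne_zero 3 hne)
  -- A continuous inverse of v ↦ v/(1+v)³ is differentiable where the derivative -(2v-1)/(1+v)⁴ does
  -- not vanish.
  refine (hder.of_local_left_inverse hcont ?_ ?_).differentiableAt.differentiableWithinAt
  · refine div_ne_zero ?_ (pow_ne_zero 2 (pow_ne_zero 3 hne))
    have : 1 * (1 + w z₀) ^ 3 - w z₀ * (↑(3 : ℕ) * (1 + w z₀) ^ (3 - 1) * 1) =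
        -((2 * w z₀ - 1) * (1 + w z₀) ^ 2) := by push_cast; ring
    rw [this]
    exact neg_ne_zero.mpr (mul_ne_zero hne' (pow_ne_zero 2 hne))
  · refine eventually_of_mem hd fun z hz => ?_
    have h := (hw z hz).2
    rw [div_eq_iff (pow_ne_zero 3 (one_add_ne_zero_of_eq h))]
    exact h.symm

/-! ### Asymptotics of binomial coefficients -/

theorem tendsto_choose_three_mul :
    Tendsto (fun n : ℕ => ((3 * n).choose n : ℝ) * (4 / 27) ^ n * √n) atTop
      (nhds (√3 / 2 / √Real.pi)) := by
  have h := Stirling.tendsto_stirlingSeq_sqrt_pi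
  have h2 := h.comp (tendsto_id.const_mul_atTop' (two_pos : 0 < 2))
  have h3 := h.comp (tendsto_id.const_mul_atTop' (three_pos : 0 < 3))
  have hpi : √Real.pi ≠ 0 := by positivity
  have key := ((h3.div (h.mul h2) (mul_ne_zero hpi hpi)).const_mul (√3 / 2))
  have e : √3 / 2 * (√Real.pi / (√Real.pi * √Real.pi)) = √3 / 2 / √Real.pi := by
    field_simp
  rw [e] at key
  refine key.congr' ?_
  filter_upwards [eventually_gt_atTop 0] with n hn
  have hn' : (0 : ℝ) < n := by exact_mod_cast hn
  have hch : ((3 * n).choose n : ℝ) = (3 * n).factorial / (n.factorial * (2 * n).factorial) := by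
    rw [Nat.cast_choose ℝ (by omega : n ≤ 3 * n), show 3 * n - n = 2 * n by omega]
  have s3 : √(2 * (3 * (n : ℝ))) = √2 * √3 * √n := by
    rw [Real.sqrt_mul (by norm_num), Real.sqrt_mul (by norm_num)]; ring
  have s2 : √(2 * (2 * (n : ℝ))) = 2 * √n := by
    rw [show 2 * (2 * (n : ℝ)) = 2 ^ 2 * n by ring, Real.sqrt_mul (by norm_num),
      Real.sqrt_sq (by norm_num)]
  have s1 : √(2 * (n : ℝ)) = √2 * √n := Real.sqrt_mul (by norm_num) _
  have p3 : (3 * (n : ℝ) / Real.exp 1) ^ (3 * n) =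
      27 ^ n * (n / Real.exp 1) ^ n * (n / Real.exp 1) ^ n * (n / Real.exp 1) ^ n := by
    rw [mul_div_assoc, mul_pow, pow_mul, pow_mul, show (3 : ℝ) ^ 3 = 27 by norm_num, ← pow_mul,
      mul_comm 3 n, pow_mul]
    ring
  have p2 : (2 * (n : ℝ) / Real.exp 1) ^ (2 * n) =
      4 ^ n * (n / Real.exp 1) ^ n * (n / Real.exp 1) ^ n := by
    rw [mul_div_assoc, mul_pow, pow_mul, pow_mul, show (2 : ℝ) ^ 2 = 4 by norm_num, ← pow_mul,
      mul_comm 2 n, pow_mul]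
    ring
  have hsq : √(n : ℝ) ≠ 0 := (Real.sqrt_pos.mpr hn').ne'
  have hE : ((n : ℝ) / Real.exp 1) ^ n ≠ 0 := by positivity
  have hf1 : (n.factorial : ℝ) ≠ 0 := by positivity
  have hf2 : ((2 * n).factorial : ℝ) ≠ 0 := by positivity
  simp only [Function.comp, Stirling.stirlingSeq, id, Nat.cast_mul, Nat.cast_ofNat, Pi.div_apply]
  rw [hch, s1, s2, s3, p2, p3]
  have h2' : √(2 : ℝ) ≠ 0 := by positivity
  generalize ((n : ℝ) / Real.exp 1) ^ n = E at hE ⊢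
  field_simp
  rw [← mul_pow]
  norm_num

theorem tendsto_centralBinom :
    Tendsto (fun n : ℕ => (n.centralBinom : ℝ) / 4 ^ n * √n) atTop (nhds (1 / √Real.pi)) := by
  have h := Stirling.tendsto_stirlingSeq_sqrt_pi
  have h2 := h.comp (tendsto_id.const_mul_atTop' (two_pos : 0 < 2))
  have hpi : √Real.pi ≠ 0 := by positivity
  have key := h2.div (h.mul h) (mul_ne_zero hpi hpi)
  have e : √Real.pi / (√Real.pi * √Real.pi) = 1 / √Real.pi := by
    field_simp
  rw [e] at key
  refine key.congr' ?_
  filter_upwards [eventually_gt_atTop 0] with n hn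
  have hn' : (0 : ℝ) < n := by exact_mod_cast hn
  have hch : (n.centralBinom : ℝ) = (2 * n).factorial / (n.factorial * n.factorial) := by
    rw [Nat.centralBinom, Nat.cast_choose ℝ (by omega : n ≤ 2 * n),
      show 2 * n - n = n by omega]
  have s2 : √(2 * (2 * (n : ℝ))) = 2 * √n := by
    rw [show 2 * (2 * (n : ℝ)) = 2 ^ 2 * n by ring, Real.sqrt_mul (by norm_num),
      Real.sqrt_sq (by norm_num)]
  have s1 : √(2 * (n : ℝ)) = √2 * √n := Real.sqrt_mul (by norm_num) _
  have p2 : (2 * (n : ℝ) / Real.exp 1) ^ (2 * n) =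
      4 ^ n * (n / Real.exp 1) ^ n * (n / Real.exp 1) ^ n := by
    rw [mul_div_assoc, mul_pow, pow_mul, pow_mul, show (2 : ℝ) ^ 2 = 4 by norm_num, ← pow_mul,
      mul_comm 2 n, pow_mul]
    ring
  have hsq : √(n : ℝ) ≠ 0 := (Real.sqrt_pos.mpr hn').ne'
  have hE : ((n : ℝ) / Real.exp 1) ^ n ≠ 0 := by positivity
  have hf1 : (n.factorial : ℝ) ≠ 0 := by positivity
  simp only [Function.comp, Stirling.stirlingSeq, id, Nat.cast_mul, Nat.cast_ofNat, Pi.div_apply]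
  rw [hch, s1, s2, p2]
  have h2' : √(2 : ℝ) ≠ 0 := by positivity
  have hr : √(2 : ℝ) ^ 2 = 2 := Real.sq_sqrt (by norm_num)
  generalize ((n : ℝ) / Real.exp 1) ^ n = E at hE ⊢
  field_simp
  rw [hr]

/-- The generating series F is (1-X)^(-1/2): from (1-X)F' = F/2 the derivative of F²(1-X) vanishes,
so F² is the geometric series. -/
theorem sum_centralBinom_mul_centralBinom (n : ℕ) :
    ∑ p ∈ Finset.HasAntidiagonal.antidiagonal n,
      ((p.1.centralBinom : ℝ) / 4 ^ p.1) * ((p.2.centralBinom : ℝ) / 4 ^ p.2) = 1 := by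
  let F : PowerSeries ℝ := PowerSeries.mk fun n => (n.centralBinom : ℝ) / 4 ^ n
  have hF : (1 - PowerSeries.X) * PowerSeries.derivative ℝ F = PowerSeries.C (1 / 2) * F := by
    have hrec : ∀ n : ℕ, ((n + 1).centralBinom : ℝ) / 4 ^ (n + 1) * (n + 1) =
        (n + 1 / 2) * ((n.centralBinom : ℝ) / 4 ^ n) := by
      intro n
      have := congrArg (Nat.cast (R := ℝ)) (Nat.succ_mul_centralBinom_succ n)
      push_cast at this
      rw [pow_succ]
      field_simp
      linear_combination 2 * this
    ext k
    rw [PowerSeries.coeff_C_mul, sub_mul, one_mul, map_sub, PowerSeries.coeff_derivative]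
    rcases k with _ | k
    · simpa [F] using hrec 0
    · rw [PowerSeries.coeff_succ_X_mul, PowerSeries.coeff_derivative]
      simp only [F, PowerSeries.coeff_mk]
      have := hrec (k + 1)
      push_cast at this ⊢
      linear_combination this
  have hF2 : F * F * (1 - PowerSeries.X) = 1 := by
    refine PowerSeries.derivative.ext ?_ (by simp [F])
    have hC : (PowerSeries.C (1 / 2 : ℝ)) * 2 = 1 := by
      rw [show (2 : PowerSeries ℝ) = PowerSeries.C 2 from (map_ofNat _ 2).symm, ← map_mul]; norm_num
    simp only [Derivation.leibniz, smul_eq_mul, map_sub, PowerSeries.derivative_X,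
      PowerSeries.derivative_one]
    linear_combination (2 * F) * hF + F * F * hC
  have hgeom : F * F = PowerSeries.mk 1 := by
    have h1 := PowerSeries.mk_one_mul_one_sub_eq_one ℝ
    calc F * F = F * F * (1 - PowerSeries.X) * PowerSeries.mk 1 := by
          rw [mul_assoc, mul_comm (1 - PowerSeries.X), h1, mul_one]
      _ = _ := by rw [hF2, one_mul]
  have := congrArg (PowerSeries.coeff n) hgeom
  simpa [PowerSeries.coeff_mul, F] using this

/-! ### Convolutions -/

section Convolution

variable {p : ℕ → ℝ} (hp0 : ∀ n, 0 < p n) (hp : Tendsto p atTop (nhds 0))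
  (hpp : ∀ n, ∑ i ∈ Finset.range (n + 1), p i * p (n - i) = 1)

include hp0 hp hpp

/-- For i ≥ N the terms are at most (η/2) p i p(n-i), with total at most η/2 since p * p = 1. The
finitely many others tend to 0 because p does. -/
theorem tendsto_convolution_of_isLittleO {r : ℕ → ℝ} (hr : r =o[atTop] p) :
    Tendsto (fun n => ∑ i ∈ Finset.range (n + 1), |r i| * p (n - i)) atTop (nhds 0) := by
  rw [Metric.tendsto_atTop]
  intro η hη
  obtain ⟨N, hN⟩ := eventually_atTop.mp (hr.def (half_pos hη))
  have hfin : Tendsto (fun n => ∑ i ∈ Finset.range N, |r i| * p (n - i)) atTop (nhds 0) := by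
    have : Tendsto (fun n => ∑ i ∈ Finset.range N, |r i| * p (n - i)) atTop
        (nhds (∑ i ∈ Finset.range N, |r i| * 0)) :=
      tendsto_finsetSum _ fun i _ => (hp.comp (tendsto_sub_atTop_nat i)).const_mul _
    simpa using this
  obtain ⟨N', hN'⟩ := Metric.tendsto_atTop.mp hfin (η / 2) (half_pos hη)
  refine ⟨max N N', fun n hn => ?_⟩
  have h1 := hN' n (le_trans (le_max_right _ _) hn)
  have hnN : N ≤ n := le_trans (le_max_left _ _) hn
  rw [Real.dist_eq, sub_zero] at h1 ⊢
  rw [abs_of_nonneg (Finset.sum_nonneg fun i _ => mul_nonneg (abs_nonneg _) (hp0 _).le)] at h1 ⊢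
  have hle : ∑ i ∈ Finset.range (n + 1), |r i| * p (n - i) ≤
      ∑ i ∈ Finset.range (n + 1), (η / 2 * (p i * p (n - i)) +
        if i < N then |r i| * p (n - i) else 0) := by
    refine Finset.sum_le_sum fun i _ => ?_
    split_ifs with hi
    · have := mul_pos (half_pos hη) (mul_pos (hp0 i) (hp0 (n - i)))
      linarith
    · have h2 := hN i (by omega)
      rw [Real.norm_eq_abs, Real.norm_eq_abs, abs_of_pos (hp0 i)] at h2
      have := mul_le_mul_of_nonneg_right h2 (hp0 (n - i)).le
      linarith
  rw [Finset.sum_add_distrib, ← Finset.mul_sum, hpp, ← Finset.sum_filter] at hle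
  have hfil : (Finset.range (n + 1)).filter (· < N) = Finset.range N := by
    ext i; simp; omega
  rw [hfil] at hle
  linarith

/-- Write v = κp + r with r = o(p). The square of κp contributes exactly κ², and every term
containing r is negligible. -/
theorem tendsto_convolution {v : ℕ → ℝ} {κ : ℝ}
    (hv : Tendsto (fun n => v n / p n) atTop (nhds κ)) :
    Tendsto (fun n => ∑ i ∈ Finset.range (n + 1), v i * v (n - i)) atTop (nhds (κ ^ 2)) := by
  set r : ℕ → ℝ := fun n => v n - κ * p n with hrdef
  have hr : r =o[atTop] p := by
    rw [isLittleO_iff_tendsto fun n h => absurd h (hp0 n).ne']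
    have : Tendsto (fun n => v n / p n - κ) atTop (nhds (κ - κ)) := hv.sub_const κ
    rw [sub_self] at this
    refine this.congr fun n => ?_
    simp only [hrdef]
    field_simp [(hp0 n).ne']
  obtain ⟨M, hM⟩ : ∃ M, ∀ n, |v n| ≤ M * p n := by
    obtain ⟨M, hM⟩ := hv.norm.bddAbove_range
    refine ⟨M, fun n => ?_⟩
    have : ‖v n / p n‖ ≤ M := hM ⟨n, rfl⟩
    rwa [norm_div, Real.norm_eq_abs, Real.norm_eq_abs, abs_of_pos (hp0 n),
      div_le_iff₀ (hp0 n)] at this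
  have hM0 : 0 ≤ M := by
    have := (abs_nonneg _).trans (hM 0)
    exact nonneg_of_mul_nonneg_left this (hp0 0)
  have h0 := tendsto_convolution_of_isLittleO hp0 hp hpp hr
  have hrefl : ∀ n, ∑ i ∈ Finset.range (n + 1), p i * r (n - i) =
      ∑ i ∈ Finset.range (n + 1), r i * p (n - i) := by
    intro n
    rw [← Finset.sum_range_reflect]
    refine Finset.sum_congr rfl fun i hi => ?_
    rw [Finset.mem_range] at hi
    rw [show n + 1 - 1 - i = n - i by omega, show n - (n - i) = i by omega, mul_comm]
  have e : ∀ n, ∑ i ∈ Finset.range (n + 1), v i * v (n - i) = κ ^ 2 +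
      (κ * ∑ i ∈ Finset.range (n + 1), r i * p (n - i) +
        ∑ i ∈ Finset.range (n + 1), r i * v (n - i)) := by
    intro n
    have : ∀ i, v i * v (n - i) = κ ^ 2 * (p i * p (n - i)) + κ * (p i * r (n - i)) +
        r i * v (n - i) := fun i => by simp only [hrdef]; ring
    simp only [this]
    rw [Finset.sum_add_distrib, Finset.sum_add_distrib, ← Finset.mul_sum, ← Finset.mul_sum, hpp,
      hrefl]
    ring
  have t1 : Tendsto (fun n => ∑ i ∈ Finset.range (n + 1), r i * p (n - i)) atTop (nhds 0) := by
    refine squeeze_zero_norm (fun n => ?_) h0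
    refine (norm_sum_le _ _).trans (Finset.sum_le_sum fun i _ => ?_)
    rw [norm_mul, Real.norm_eq_abs, Real.norm_eq_abs, abs_of_pos (hp0 _)]
  have t2 : Tendsto (fun n => ∑ i ∈ Finset.range (n + 1), r i * v (n - i)) atTop (nhds 0) := by
    have h0' := h0.const_mul M
    rw [mul_zero] at h0'
    refine squeeze_zero_norm (fun n => ?_) h0'
    refine (norm_sum_le _ _).trans ?_
    rw [Finset.mul_sum]
    refine Finset.sum_le_sum fun i _ => ?_
    rw [norm_mul, Real.norm_eq_abs, Real.norm_eq_abs]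
    calc |r i| * |v (n - i)| ≤ |r i| * (M * p (n - i)) := by gcongr; exact hM _
      _ = _ := by ring
  simp only [e]
  simpa using (((t1.const_mul κ).add t2).const_add (κ ^ 2))

end Convolution

theorem tendsto_convolution_choose :
    Tendsto (fun n : ℕ => ∑ i ∈ Finset.range (n + 1),
      (((3 * i).choose i : ℝ) * (4 / 27) ^ i) *
        (((3 * (n - i)).choose (n - i) : ℝ) * (4 / 27) ^ (n - i))) atTop (nhds (3 / 4)) := by
  have hpi : √Real.pi ≠ 0 := by positivity
  have hc := tendsto_centralBinom
  have hratio := tendsto_choose_three_mul.div hc (by positivity)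
  have e : √3 / 2 / √Real.pi / (1 / √Real.pi) = √3 / 2 := by field_simp
  rw [e] at hratio
  have hp : Tendsto (fun n : ℕ => (n.centralBinom : ℝ) / 4 ^ n) atTop (nhds 0) := by
    have h := hc.mul ((Real.tendsto_sqrt_atTop.comp
      tendsto_natCast_atTop_atTop).inv_tendsto_atTop)
    rw [mul_zero] at h
    refine h.congr' ?_
    filter_upwards [eventually_gt_atTop 0] with n hn
    have : √(n : ℝ) ≠ 0 := (Real.sqrt_pos.mpr (by exact_mod_cast hn)).ne'
    simp only [Function.comp, Pi.inv_apply]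
    field_simp
  have h := tendsto_convolution (p := fun n : ℕ => (n.centralBinom : ℝ) / 4 ^ n)
    (v := fun n : ℕ => ((3 * n).choose n : ℝ) * (4 / 27) ^ n) (κ := √3 / 2)
    (fun n => div_pos (by exact_mod_cast n.centralBinom_pos) (by positivity)) hp
    (fun n => by
      rw [← sum_centralBinom_mul_centralBinom n,
        Finset.Nat.sum_antidiagonal_eq_sum_range_succ fun i j =>
          ((i.centralBinom : ℝ) / 4 ^ i) * ((j.centralBinom : ℝ) / 4 ^ j)])
    (hratio.congr' (by
      filter_upwards [eventually_gt_atTop 0] with n hn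
      have : √(n : ℝ) ≠ 0 := (Real.sqrt_pos.mpr (by exact_mod_cast hn)).ne'
      simp only [Pi.div_apply]
      rw [mul_div_mul_right _ _ this]))
  rwa [div_pow, Real.sq_sqrt (by norm_num), show (2 : ℝ) ^ 2 = 4 by norm_num] at h

/-! ### Taylor coefficients at the origin -/

/-- The `n`-th Taylor coefficient at `0`. -/
def seriesCoeff (f : ℂ → ℂ) (n : ℕ) : ℂ := iteratedDeriv n f 0 / (n.factorial : ℂ)

theorem seriesCoeff_congr {f g : ℂ → ℂ} (h : ∀ z ∈ disc, f z = g z) (n : ℕ) :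
    seriesCoeff f n = seriesCoeff g n := by
  have : f =ᶠ[nhds 0] g := eventually_of_mem (isOpen_disc.mem_nhds zero_mem_disc) h
  rw [seriesCoeff, seriesCoeff, this.iteratedDeriv_eq]

theorem seriesCoeff_zero_eq (f : ℂ → ℂ) : seriesCoeff f 0 = f 0 := by simp [seriesCoeff]

theorem seriesCoeff_add {f g : ℂ → ℂ} (hf : AnalyticAt ℂ f 0) (hg : AnalyticAt ℂ g 0) (n : ℕ) :
    seriesCoeff (fun z => f z + g z) n = seriesCoeff f n + seriesCoeff g n := by
  rw [seriesCoeff, iteratedDeriv_fun_add hf.contDiffAt hg.contDiffAt, add_div]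
  rfl

theorem seriesCoeff_const_mul (c : ℂ) (f : ℂ → ℂ) (n : ℕ) :
    seriesCoeff (fun z => c * f z) n = c * seriesCoeff f n := by
  rw [seriesCoeff, iteratedDeriv_const_mul_field, mul_div_assoc]
  rfl

theorem seriesCoeff_const {n : ℕ} (hn : n ≠ 0) (c : ℂ) : seriesCoeff (fun _ => c) n = 0 := by
  simp [seriesCoeff, iteratedDeriv_const, hn]

theorem seriesCoeff_mul {f g : ℂ → ℂ} (hf : AnalyticAt ℂ f 0) (hg : AnalyticAt ℂ g 0) (n : ℕ) :
    seriesCoeff (fun z => f z * g z) n =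
      ∑ i ∈ Finset.range (n + 1), seriesCoeff f i * seriesCoeff g (n - i) := by
  rw [seriesCoeff, iteratedDeriv_fun_mul hf.contDiffAt hg.contDiffAt, Finset.sum_div]
  refine Finset.sum_congr rfl fun i hi => ?_
  have hi' : i ≤ n := by rw [Finset.mem_range] at hi; omega
  rw [seriesCoeff, seriesCoeff, Nat.cast_choose ℂ hi']
  have h1 : (n.factorial : ℂ) ≠ 0 := by exact_mod_cast n.factorial_ne_zero
  have h2 : (i.factorial : ℂ) ≠ 0 := by exact_mod_cast i.factorial_ne_zero
  have h3 : ((n - i).factorial : ℂ) ≠ 0 := by exact_mod_cast (n - i).factorial_ne_zero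
  field_simp

theorem seriesCoeff_id_mul {f : ℂ → ℂ} (hf : AnalyticAt ℂ f 0) (n : ℕ) :
    seriesCoeff (fun z => z * f z) (n + 1) = seriesCoeff f n := by
  have hid : ∀ i, seriesCoeff (fun z : ℂ => z) i = if i = 1 then 1 else 0 := by
    intro i
    rw [seriesCoeff, iteratedDeriv_fun_id_zero]
    split_ifs with h <;> simp [h]
  rw [seriesCoeff_mul (f := fun z => z) analyticAt_id hf, Finset.sum_eq_single 1]
  · simp [hid]
  · intro i _ hi
    simp [hid, hi]
  · intro h
    simp at h

theorem seriesCoeff_delta {f : ℂ → ℂ} (hf : AnalyticAt ℂ f 0) (n : ℕ) :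
    seriesCoeff (delta f) n = n * seriesCoeff f n := by
  rcases n with _ | n
  · simp [seriesCoeff_zero_eq, delta]
  · rw [show delta f = fun z => z * deriv f z from rfl, seriesCoeff_id_mul hf.deriv, seriesCoeff, seriesCoeff,
      iteratedDeriv_succ', Nat.factorial_succ]
    have h1 : (n.factorial : ℂ) ≠ 0 := by exact_mod_cast n.factorial_ne_zero
    have h2 : ((n + 1 : ℕ) : ℂ) ≠ 0 := by exact_mod_cast n.succ_ne_zero
    push_cast at h2 ⊢
    field_simp

theorem analyticAt_delta {f : ℂ → ℂ} (hf : AnalyticAt ℂ f 0) : AnalyticAt ℂ (delta f) 0 :=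
  analyticAt_id.mul hf.deriv

theorem analyticAt_const_mul (c : ℂ) {f : ℂ → ℂ} (hf : AnalyticAt ℂ f 0) :
    AnalyticAt ℂ (fun z => c * f z) 0 :=
  analyticAt_const.mul hf

/-! ### Coefficient asymptotics -/

/-- The `n`-th Taylor coefficient of `f` at `0` is `(c + o(1)) n^(α - 1) (27/4)^n`. -/
structure CoeffAsymp (f : ℂ → ℂ) (α : ℝ) (c : ℂ) : Prop where
  analytic : AnalyticAt ℂ f 0
  tendsto : Tendsto (fun n : ℕ => seriesCoeff f n * (4 / 27) ^ n * (((n : ℝ) ^ (1 - α) : ℝ) : ℂ))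
    atTop (nhds c)

namespace CoeffAsymp

variable {f g : ℂ → ℂ} {α β : ℝ} {c d : ℂ}

theorem add (hf : CoeffAsymp f α c) (hg : CoeffAsymp g α d) :
    CoeffAsymp (fun z => f z + g z) α (c + d) := by
  refine ⟨hf.analytic.add hg.analytic, (hf.tendsto.add hg.tendsto).congr fun n => ?_⟩
  rw [seriesCoeff_add hf.analytic hg.analytic]
  ring

theorem const_mul (a : ℂ) (hf : CoeffAsymp f α c) :
    CoeffAsymp (fun z => a * f z) α (a * c) := by
  refine ⟨analyticAt_const.mul hf.analytic, (hf.tendsto.const_mul a).congr fun n => ?_⟩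
  rw [seriesCoeff_const_mul]
  ring

theorem congr (hf : CoeffAsymp f α c) (h : ∀ z ∈ disc, g z = f z) : CoeffAsymp g α c := by
  refine ⟨hf.analytic.congr (eventually_of_mem (isOpen_disc.mem_nhds zero_mem_disc)
    fun z hz => (h z hz).symm), hf.tendsto.congr fun n => ?_⟩
  rw [seriesCoeff_congr h]

/-- A zero constant encodes an o-bound; this is how lower-order terms are discarded. -/
theorem weaken (hf : CoeffAsymp f α c) (h : α < β) : CoeffAsymp f β 0 := by
  refine ⟨hf.analytic, ?_⟩
  have h1 : Tendsto (fun n : ℕ => (((n : ℝ) ^ (-(β - α)) : ℝ) : ℂ)) atTop (nhds ((0 : ℝ) : ℂ)) :=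
    (Complex.continuous_ofReal.tendsto 0).comp
      ((tendsto_rpow_neg_atTop (sub_pos.mpr h)).comp tendsto_natCast_atTop_atTop)
  have h2 := hf.tendsto.mul h1
  rw [Complex.ofReal_zero, mul_zero] at h2
  refine h2.congr' ?_
  filter_upwards [eventually_gt_atTop 0] with n hn
  rw [mul_assoc, ← Complex.ofReal_mul, ← Real.rpow_add (by exact_mod_cast hn)]
  congr 3
  ring

theorem delta (hf : CoeffAsymp f α c) : CoeffAsymp (delta f) (α + 1) c := by
  refine ⟨analyticAt_delta hf.analytic, hf.tendsto.congr' ?_⟩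
  filter_upwards [eventually_gt_atTop 0] with n hn
  have hn' : (0 : ℝ) < n := by exact_mod_cast hn
  have e : (n : ℝ) ^ (1 - α) = n * (n : ℝ) ^ (1 - (α + 1)) := by
    rw [show 1 - α = 1 + (1 - (α + 1)) by ring, Real.rpow_add hn', Real.rpow_one]
  rw [seriesCoeff_delta hf.analytic, e]
  push_cast
  ring

theorem const (a : ℂ) (α : ℝ) : CoeffAsymp (fun _ => a) α 0 := by
  refine ⟨analyticAt_const, tendsto_const_nhds.congr' ?_⟩
  filter_upwards [eventually_gt_atTop 0] with n hn
  rw [seriesCoeff_const (by omega)]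
  simp

end CoeffAsymp

/-! ### Coefficients of the coordinate -/

theorem choose_three_mul_succ (n : ℕ) :
    ((n : ℂ) + 1) * (4 * n + 2) * ((3 * (n + 1)).choose (n + 1) : ℂ) =
      (27 * n ^ 2 + 27 * n + 6) * ((3 * n).choose n : ℂ) := by
  rw [Nat.cast_choose ℂ (by omega : n ≤ 3 * n),
    Nat.cast_choose ℂ (by omega : n + 1 ≤ 3 * (n + 1)), show 3 * n - n = 2 * n by omega,
    show 3 * (n + 1) - (n + 1) = 2 * n + 1 + 1 by omega,
    show 3 * (n + 1) = 3 * n + 1 + 1 + 1 by omega, Nat.factorial_succ (3 * n + 1 + 1),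
    Nat.factorial_succ (3 * n + 1), Nat.factorial_succ (3 * n), Nat.factorial_succ (2 * n + 1),
    Nat.factorial_succ (2 * n), Nat.factorial_succ n]
  have h1 : (n.factorial : ℂ) ≠ 0 := by exact_mod_cast n.factorial_ne_zero
  have h2 : ((2 * n).factorial : ℂ) ≠ 0 := by exact_mod_cast (2 * n).factorial_ne_zero
  have h3 : ((n + 1 : ℕ) : ℂ) ≠ 0 := by exact_mod_cast n.succ_ne_zero
  have h4 : ((2 * n + 1 : ℕ) : ℂ) ≠ 0 := by exact_mod_cast (2 * n).succ_ne_zero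
  push_cast at h3 h4 ⊢
  rw [show 2 * (n : ℂ) + 1 + 1 = 2 * (n + 1) by ring, mul_div_assoc', mul_div_assoc',
    div_eq_div_iff (by simp [h1, h2, h3, h4]) (by simp [h1, h2])]
  ring

namespace IsBranch

variable {w : ℂ → ℂ} (hw : IsBranch w)

include hw

theorem analyticAt : AnalyticAt ℂ w 0 :=
  hw.holomorphic.analyticAt (isOpen_disc.mem_nhds zero_mem_disc)

theorem analyticAt_coord : AnalyticAt ℂ (coord w) 0 :=
  hw.analyticAt.div ((analyticAt_const.mul hw.analyticAt).sub analyticAt_const)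
    (hw.two_mul_sub_one_ne_zero zero_mem_disc)

theorem apply_zero : w 0 = 0 := by
  have := hw.eq 0 zero_mem_disc
  rw [zero_mul] at this
  exact this.symm

/-- The Taylor coefficients of `1 - 3 y` are the numbers `(3n choose n)`. -/
theorem seriesCoeff_one_sub_three_coord (n : ℕ) :
    seriesCoeff (fun z => aeval (coord w z) (1 - 3 * X : ℤ[X])) n = ((3 * n).choose n : ℂ) := by
  set P : ℤ[X] := 1 - 3 * X with hP
  set g : ℂ → ℂ := fun z => aeval (coord w z) P with hg
  have hga : AnalyticAt ℂ g 0 := by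
    have : g = fun z => 1 - 3 * coord w z := by
      ext z; simp [hg, hP, map_ofNat]
    rw [this]
    exact analyticAt_const.sub (analyticAt_const_mul _ hw.analyticAt_coord)
  have d1 : ∀ z ∈ disc, delta g z = aeval (coord w z) ((2 * X - 1) * theta P) :=
    fun z hz => hw.delta_aeval_coord hz P
  have d2 : ∀ z ∈ disc, delta (delta g) z =
      aeval (coord w z) ((2 * X - 1) * theta ((2 * X - 1) * theta P)) := fun z hz => by
    rw [delta_congr d1 hz, hw.delta_aeval_coord hz]
  have a1 := analyticAt_delta hga
  have a2 := analyticAt_delta a1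
  -- The hypergeometric equation 2δ(2δ-1)g = 3z(3δ+1)(3δ+2)g, whose coefficient recursion is that of
  -- (3n choose n).
  have ode : ∀ z ∈ disc, 4 * delta (delta g) z + -2 * delta g z =
      z * (27 * delta (delta g) z + (27 * delta g z + 6 * g z)) := by
    intro z hz
    have r1 := hw.one_add_mul hz
    have r2 := hw.eq z hz
    have rel : z * (3 * coord w z - 1) ^ 3 = coord w z * (2 * coord w z - 1) ^ 2 := by
      rw [← r1]
      linear_combination (2 * coord w z - 1) ^ 3 * r2 + (2 * coord w z - 1) ^ 2 * r1
    rw [d1 z hz, d2 z hz]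
    simp only [hg, hP, theta, derivative_mul, derivative_X, derivative_one,
      derivative_ofNat, map_mul, map_sub, map_add, aeval_X, map_ofNat, map_one, map_zero]
    linear_combination (6 * (3 * coord w z - 1) * (18 * coord w z - 1)) * rel
  have hrec : ∀ n : ℕ, ((n : ℂ) + 1) * (4 * n + 2) * seriesCoeff g (n + 1) =
      (27 * n ^ 2 + 27 * n + 6) * seriesCoeff g n := by
    intro n
    have h := seriesCoeff_congr ode (n + 1)
    have b2 : AnalyticAt ℂ
        (fun z => 27 * delta (delta g) z + (27 * delta g z + 6 * g z)) 0 :=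
      (analyticAt_const_mul _ a2).add ((analyticAt_const_mul _ a1).add (analyticAt_const_mul _ hga))
    have b1 : AnalyticAt ℂ (fun z => 27 * delta g z + 6 * g z) 0 :=
      (analyticAt_const_mul _ a1).add (analyticAt_const_mul _ hga)
    rw [seriesCoeff_add (analyticAt_const_mul _ a2) (analyticAt_const_mul _ a1), seriesCoeff_const_mul,
      seriesCoeff_const_mul, seriesCoeff_id_mul b2,
      seriesCoeff_add (analyticAt_const_mul _ a2) b1,
      seriesCoeff_add (analyticAt_const_mul _ a1) (analyticAt_const_mul _ hga), seriesCoeff_const_mul,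
      seriesCoeff_const_mul, seriesCoeff_const_mul, seriesCoeff_delta a1, seriesCoeff_delta hga, seriesCoeff_delta a1,
      seriesCoeff_delta hga] at h
    push_cast at h
    linear_combination h
  induction n with
  | zero => simp [seriesCoeff_zero_eq, hg, hP, coord, hw.apply_zero]
  | succ n ih =>
    have h := (hrec n).trans (by rw [ih, ← choose_three_mul_succ])
    refine mul_left_cancel₀ (mul_ne_zero ?_ ?_) h
    · exact_mod_cast n.succ_ne_zero
    · exact_mod_cast (4 * n + 1).succ_ne_zero

theorem seriesCoeff_coord {n : ℕ} (hn : n ≠ 0) :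
    seriesCoeff (coord w) n = -(1 / 3) * ((3 * n).choose n : ℂ) := by
  rw [← hw.seriesCoeff_one_sub_three_coord n]
  have h : (fun z => aeval (coord w z) (1 - 3 * X : ℤ[X])) =
      fun z => (fun _ => (1 : ℂ)) z + (-3) * coord w z := by
    ext z; simp [map_ofNat]; ring
  rw [h, seriesCoeff_add analyticAt_const (analyticAt_const_mul _ hw.analyticAt_coord), seriesCoeff_const hn,
    seriesCoeff_const_mul]
  ring

theorem coeffAsymp_coord :
    CoeffAsymp (coord w) (1 / 2) (((-(1 / (2 * √3)) / √Real.pi : ℝ) : ℂ)) := by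
  refine ⟨hw.analyticAt_coord, ?_⟩
  have h := (Complex.continuous_ofReal.tendsto _).comp
    (tendsto_choose_three_mul.const_mul (-(1 / 3)))
  have e : -(1 / 3) * (√3 / 2 / √Real.pi) = -(1 / (2 * √3)) / √Real.pi := by
    have : √(3 : ℝ) ^ 2 = 3 := Real.sq_sqrt (by norm_num)
    have h3 : √(3 : ℝ) ≠ 0 := by positivity
    field_simp
    linarith
  rw [e] at h
  refine h.congr' ?_
  filter_upwards [eventually_gt_atTop 0] with n hn
  rw [hw.seriesCoeff_coord (by omega), show (1 : ℝ) - 1 / 2 = 1 / 2 by norm_num, ← Real.sqrt_eq_rpow]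
  simp only [Function.comp]
  push_cast
  ring

theorem coeffAsymp_coord_sq : CoeffAsymp (fun z => coord w z ^ 2) 1 (1 / 12) := by
  set g : ℂ → ℂ := fun z => aeval (coord w z) (1 - 3 * X : ℤ[X]) with hg
  have hgz : g = fun z => 1 - 3 * coord w z := by ext z; simp [hg, map_ofNat]
  have hga : AnalyticAt ℂ g 0 := by
    rw [hgz]
    exact analyticAt_const.sub (analyticAt_const_mul _ hw.analyticAt_coord)
  have hgg : CoeffAsymp (fun z => g z * g z) 1 ((3 / 4 : ℝ) : ℂ) := by
    refine ⟨hga.mul hga, ?_⟩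
    have h := (Complex.continuous_ofReal.tendsto _).comp tendsto_convolution_choose
    refine h.congr fun n => ?_
    rw [seriesCoeff_mul hga hga, sub_self, Real.rpow_zero, Complex.ofReal_one, mul_one,
      Finset.sum_mul]
    simp only [Function.comp]
    push_cast
    refine Finset.sum_congr rfl fun i hi => ?_
    have hi' : i ≤ n := by rw [Finset.mem_range] at hi; omega
    rw [hw.seriesCoeff_one_sub_three_coord, hw.seriesCoeff_one_sub_three_coord]
    have : ((4 : ℂ) / 27) ^ n = (4 / 27) ^ i * (4 / 27) ^ (n - i) := by
      rw [← pow_add]; congr 1; omega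
    rw [this]
    ring
  have h1 := (hw.coeffAsymp_coord.weaken (show (1 / 2 : ℝ) < 1 by norm_num)).const_mul (2 / 3)
  have h := ((hgg.const_mul (1 / 9)).add h1).add (CoeffAsymp.const (-(1 / 9)) 1)
  have e : (1 / 9 : ℂ) * ((3 / 4 : ℝ) : ℂ) + 2 / 3 * 0 + 0 = 1 / 12 := by push_cast; norm_num
  rw [e] at h
  refine h.congr fun z _ => ?_
  simp only [hgz]
  ring

/-- From δ(y^j) = j y^j (6y² - 5y + 1), the power y^(j+2) is δ(y^j)/(6j) plus lower-order terms. The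
factor 1/(6j) is (1/12)/(j/2), which matches (-1/(2√3))² and Γ(j/2 + 1) = (j/2)Γ(j/2). -/
theorem coeffAsymp_coord_pow (j : ℕ) (hj : 1 ≤ j) :
    CoeffAsymp (fun z => coord w z ^ j) ((j : ℝ) / 2)
      (((-(1 / (2 * √3))) ^ j / Real.Gamma ((j : ℝ) / 2) : ℝ) : ℂ) := by
  induction j using Nat.twoStepInduction with
  | zero => omega
  | one =>
    have h := hw.coeffAsymp_coord
    rw [Nat.cast_one, Real.Gamma_one_half_eq]
    simpa using h
  | more j ih1 ih2 =>
    -- The recursion divides by j, so y² cannot come from y⁰ and needs the convolution estimate.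
    rcases Nat.eq_zero_or_pos j with rfl | hj0
    · have h := hw.coeffAsymp_coord_sq
      have e : (((-(1 / (2 * √3))) ^ (0 + 2) / Real.Gamma (((0 + 2 : ℕ) : ℝ) / 2) : ℝ) : ℂ) =
          1 / 12 := by
        have : √(3 : ℝ) ^ 2 = 3 := Real.sq_sqrt (by norm_num)
        have : (-(1 / (2 * √3))) ^ (0 + 2) / Real.Gamma (((0 + 2 : ℕ) : ℝ) / 2) = 1 / 12 := by
          norm_num [div_pow, mul_pow, this]
        rw [this]; push_cast; rfl
      rw [e]
      simpa using h
    have hj' : (0 : ℝ) < j := by exact_mod_cast hj0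
    have hjc : (j : ℂ) ≠ 0 := by exact_mod_cast hj0.ne'
    have h0 := ih1 hj0
    have t1 := h0.delta.const_mul (1 / (6 * j))
    have t2 := ((ih2 (by omega)).weaken
      (show ((j + 1 : ℕ) : ℝ) / 2 < (j : ℝ) / 2 + 1 by push_cast; linarith)).const_mul (5 / 6)
    have t3 := (h0.weaken (show (j : ℝ) / 2 < (j : ℝ) / 2 + 1 by linarith)).const_mul (-(1 / 6))
    have h := (t1.add t2).add t3
    rw [show ((j + 2 : ℕ) : ℝ) / 2 = (j : ℝ) / 2 + 1 by push_cast; ring,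
      Real.Gamma_add_one (by positivity)]
    have e : (1 / (6 * (j : ℂ))) * (((-(1 / (2 * √3))) ^ j / Real.Gamma ((j : ℝ) / 2) : ℝ) : ℂ) +
        5 / 6 * 0 + -(1 / 6) * 0 =
        (((-(1 / (2 * √3))) ^ (j + 2) / ((j : ℝ) / 2 * Real.Gamma ((j : ℝ) / 2)) : ℝ) : ℂ) := by
      have h3 : (-(1 / (2 * √3))) ^ 2 = 1 / 12 := by
        have : √(3 : ℝ) ^ 2 = 3 := Real.sq_sqrt (by norm_num)
        norm_num [div_pow, mul_pow, this]
      have hG : Real.Gamma ((j : ℝ) / 2) ≠ 0 := (Real.Gamma_pos_of_pos (by positivity)).ne'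
      have : (-(1 / (2 * √3))) ^ (j + 2) / ((j : ℝ) / 2 * Real.Gamma ((j : ℝ) / 2)) =
          1 / (6 * j) * ((-(1 / (2 * √3))) ^ j / Real.Gamma ((j : ℝ) / 2)) := by
        rw [pow_add, h3]
        field_simp
        norm_num
      rw [this]
      push_cast
      ring
    rw [e] at h
    refine h.congr fun z hz => ?_
    have hd : DegenerateP3.delta (fun z => coord w z ^ j) z =
        j * coord w z ^ j * ((3 * coord w z - 1) * (2 * coord w z - 1)) := by
      have := hw.delta_aeval_coord hz (X ^ j : ℤ[X])
      simp only [map_pow, aeval_X] at this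
      rw [this]
      obtain ⟨i, rfl⟩ : ∃ i, j = i + 1 := ⟨j - 1, by omega⟩
      simp [theta, derivative_pow, map_ofNat]
      ring
    simp only [hd]
    field_simp
    ring

/-- Since y(1+w) = w/2 + 3y/2, one has δw + w/2 = -3y/2; on coefficients this is division by n +
1/2. -/
theorem coeffAsymp_self : CoeffAsymp w (-(1 / 2)) (((√3 / (4 * √Real.pi) : ℝ) : ℂ)) := by
  refine ⟨hw.analyticAt, ?_⟩
  have hrel : ∀ n : ℕ, (n : ℂ) * seriesCoeff w n + 1 / 2 * seriesCoeff w n = -(3 / 2) * seriesCoeff (coord w) n := by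
    intro n
    rw [← seriesCoeff_delta hw.analyticAt, ← seriesCoeff_const_mul, ← seriesCoeff_const_mul,
      ← seriesCoeff_add (analyticAt_delta hw.analyticAt) (analyticAt_const_mul _ hw.analyticAt)]
    refine seriesCoeff_congr (fun z hz => ?_) n
    simp only [DegenerateP3.delta]
    linear_combination hw.deriv_relation hz - (1 / 2) * hw.coord_mul hz
  have hlim : Tendsto (fun n : ℕ => ((-(3 / 2) * ((n : ℝ) / (n + 1 / 2)) : ℝ) : ℂ)) atTop
      (nhds ((-(3 / 2) * 1 : ℝ) : ℂ)) :=
    (Complex.continuous_ofReal.tendsto _).comp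
      ((tendsto_natCast_div_add_atTop (1 / 2 : ℝ)).const_mul _)
  have h := hlim.mul hw.coeffAsymp_coord.tendsto
  have e : ((-(3 / 2) * 1 : ℝ) : ℂ) * ((-(1 / (2 * √3)) / √Real.pi : ℝ) : ℂ) =
      ((√3 / (4 * √Real.pi) : ℝ) : ℂ) := by
    rw [← Complex.ofReal_mul]
    congr 1
    have : √(3 : ℝ) ^ 2 = 3 := Real.sq_sqrt (by norm_num)
    have h3 : √(3 : ℝ) ≠ 0 := by positivity
    field_simp
    linarith
  rw [e] at h
  refine h.congr' ?_
  filter_upwards [eventually_gt_atTop 0] with n hn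
  have hn' : (0 : ℝ) < n := by exact_mod_cast hn
  have hnc : (n : ℂ) + 1 / 2 ≠ 0 := by
    have : ((n + 1 / 2 : ℝ) : ℂ) ≠ 0 := by
      rw [Complex.ofReal_ne_zero]; positivity
    push_cast at this
    exact this
  have e2 : (n : ℝ) ^ (1 - -(1 / 2) : ℝ) = n * (n : ℝ) ^ (1 - 1 / 2 : ℝ) := by
    rw [← Real.rpow_one_add' hn'.le (by norm_num)]
    norm_num
  have e3 : seriesCoeff w n = -(3 / 2) / ((n : ℂ) + 1 / 2) * seriesCoeff (coord w) n := by
    rw [div_mul_eq_mul_div, eq_div_iff hnc]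
    linear_combination hrel n
  rw [e2, e3]
  push_cast
  field_simp

/-- At the singularity w = 1/2, so to leading order 1+w acts as the constant 3/2. The identity
`step` makes this exact, with remainders of lower order. -/
theorem coeffAsymp_one_add_mul_coord_pow (j : ℕ) (hj : 1 ≤ j) :
    CoeffAsymp (fun z => (1 + w z) * coord w z ^ j) ((j : ℝ) / 2)
      ((3 / 2 * ((-(1 / (2 * √3))) ^ j / Real.Gamma ((j : ℝ) / 2)) : ℝ) : ℂ) := by
  have step : ∀ j : ℕ, ∀ z ∈ disc, (1 + w z) * coord w z ^ (j + 1) =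
      3 / 2 * coord w z ^ (j + 1) + (1 / 2 * ((1 + w z) * coord w z ^ j) +
        -(1 / 2) * coord w z ^ j) := fun j z hz => by
    linear_combination (1 / 2) * coord w z ^ j * hw.coord_mul hz
  induction j, hj using Nat.le_induction with
  | base =>
    have h := (hw.coeffAsymp_coord_pow 1 le_rfl).const_mul (3 / 2)
    have h1 := (hw.coeffAsymp_self.weaken (show -(1 / 2) < ((1 : ℕ) : ℝ) / 2 by norm_num)).const_mul
      (1 / 2)
    have h2 := h.add h1
    push_cast at h2 ⊢
    rw [mul_zero, add_zero] at h2
    refine h2.congr fun z hz => ?_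
    rw [step 0 z hz]
    ring
  | succ j hj ih =>
    have hlt : (j : ℝ) / 2 < ((j + 1 : ℕ) : ℝ) / 2 := by push_cast; linarith
    have h := (hw.coeffAsymp_coord_pow (j + 1) (by omega)).const_mul (3 / 2)
    have h1 := (ih.weaken hlt).const_mul (1 / 2)
    have h2 := ((hw.coeffAsymp_coord_pow j hj).weaken hlt).const_mul (-(1 / 2))
    have h3 := h.add (h1.add h2)
    rw [mul_zero, mul_zero, add_zero, add_zero] at h3
    rw [Complex.ofReal_mul]
    push_cast at h3 ⊢
    exact h3.congr fun z hz => step j z hz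

end IsBranch

/-! ### Asymptotics of the terms of the formal solution -/

theorem IsBranch.coeffAsymp_branchTerm {w : ℂ → ℂ} (hw : IsBranch w) {m : ℕ} (hm : 1 ≤ m)
    {P : ℤ[X]} (hP : P.natDegree ≤ m) :
    CoeffAsymp (branchTerm w P) ((m : ℝ) / 2)
      ((P.coeff m * (3 / 2 * ((-(1 / (2 * √3))) ^ m / Real.Gamma ((m : ℝ) / 2))) : ℝ) : ℂ) := by
  have hlow : ∀ N ≤ m, CoeffAsymp
      (fun z => ∑ i ∈ Finset.range N, (P.coeff i : ℂ) * ((1 + w z) * coord w z ^ i))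
      ((m : ℝ) / 2) 0 := by
    intro N hN
    induction N with
    | zero => simpa using CoeffAsymp.const 0 ((m : ℝ) / 2)
    | succ N ih =>
      simp only [Finset.sum_range_succ]
      have hterm : CoeffAsymp (fun z => (1 + w z) * coord w z ^ N) ((m : ℝ) / 2) 0 := by
        rcases Nat.eq_zero_or_pos N with rfl | hN0
        · have h := (CoeffAsymp.const 1 ((m : ℝ) / 2)).add
            (hw.coeffAsymp_self.weaken (show -(1 / 2) < (m : ℝ) / 2 by
              have : (0 : ℝ) ≤ m := by positivity
              linarith))
          simpa using h
        · refine (hw.coeffAsymp_one_add_mul_coord_pow N hN0).weaken ?_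
          have : (N : ℝ) < m := by exact_mod_cast hN
          linarith
      simpa using (ih (by omega)).add (hterm.const_mul (P.coeff N : ℂ))
  have h := (hlow m le_rfl).add
    ((hw.coeffAsymp_one_add_mul_coord_pow m hm).const_mul (P.coeff m : ℂ))
  rw [zero_add] at h
  push_cast at h ⊢
  refine h.congr fun z _ => ?_
  rw [branchTerm, aeval_eq_sum_range' (Nat.lt_succ_of_le hP), Finset.mul_sum,
    Finset.sum_range_succ]
  simp only [zsmul_eq_mul]
  rw [mul_left_comm]
  congr 1
  exact Finset.sum_congr rfl fun i _ => by ring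

theorem CoeffAsymp.isEquivalent {f : ℂ → ℂ} {α : ℝ} {c : ℝ} (hf : CoeffAsymp f α (c : ℂ))
    (hc : c ≠ 0) : (fun n : ℕ => seriesCoeff f n) ~[atTop]
      (fun n : ℕ => ((c * (n : ℝ) ^ (α - 1) * ((3 : ℝ) ^ 3 / 2 ^ 2) ^ n : ℝ) : ℂ)) := by
  have hcc : (c : ℂ) ≠ 0 := by exact_mod_cast hc
  apply isEquivalent_of_tendsto_one
  have h := hf.tendsto.div_const (c : ℂ)
  rw [div_self hcc] at h
  refine h.congr' ?_
  filter_upwards [eventually_gt_atTop 0] with n hn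
  have hn' : (0 : ℝ) < n := by exact_mod_cast hn
  have e1 : (n : ℝ) ^ (α - 1) * (n : ℝ) ^ (1 - α) = 1 := by
    rw [← Real.rpow_add hn']
    simp
  have e2 : ((3 : ℝ) ^ 3 / 2 ^ 2) ^ n * (4 / 27) ^ n = 1 := by
    rw [← mul_pow]
    norm_num
  have e1' : ((((n : ℝ) ^ (α - 1) : ℝ) : ℂ)) * (((n : ℝ) ^ (1 - α) : ℝ) : ℂ) = 1 := by
    rw [← Complex.ofReal_mul, e1, Complex.ofReal_one]
  have e2' : ((((3 : ℝ) ^ 3 / 2 ^ 2) ^ n : ℝ) : ℂ) * (4 / 27) ^ n = 1 := by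
    have := congrArg Complex.ofReal e2
    push_cast at this ⊢
    exact this
  rw [Pi.div_apply, Complex.ofReal_mul, Complex.ofReal_mul]
  have n1 := left_ne_zero_of_mul_eq_one e1'
  have n2 := left_ne_zero_of_mul_eq_one e2'
  rw [div_eq_div_iff hcc (mul_ne_zero (mul_ne_zero hcc n1) n2)]
  linear_combination (seriesCoeff f n * c * (4 / 27) ^ n * ((((3 : ℝ) ^ 3 / 2 ^ 2) ^ n : ℝ) : ℂ)) * e1' +
    (seriesCoeff f n * c) * e2'

/-! ### The polynomials `R` -/

/-- The polynomial `(2X - 1)^m Q(X / (2X - 1))`. -/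
def mobiusPoly (m : ℕ) (Q : ℤ[X]) : ℤ[X] :=
  ∑ i ∈ Finset.range (m + 1), C (Q.coeff i) * (X ^ i * (2 * X - 1) ^ (m - i))

theorem natDegree_mobiusPoly_le (m : ℕ) (Q : ℤ[X]) : (mobiusPoly m Q).natDegree ≤ m := by
  refine natDegree_sum_le_of_forall_le _ _ fun i hi => ?_
  have hi' : i ≤ m := by rw [Finset.mem_range] at hi; omega
  refine (natDegree_C_mul_le _ _).trans ((natDegree_mul_le_of_le (natDegree_X_pow_le i)
    (natDegree_pow_le_of_le (m - i) natDegree_two_X_sub_one_le)).trans ?_)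
  omega

theorem aeval_mobiusPoly {m : ℕ} {Q : ℤ[X]} (hQ : Q.natDegree ≤ m) {x : ℂ} (hx : 2 * x - 1 ≠ 0) :
    aeval x (mobiusPoly m Q) = (2 * x - 1) ^ m * aeval (x / (2 * x - 1)) Q := by
  rw [mobiusPoly, aeval_eq_sum_range' (Nat.lt_succ_of_le hQ), map_sum, Finset.mul_sum]
  refine Finset.sum_congr rfl fun i hi => ?_
  have hi' : i ≤ m := by rw [Finset.mem_range] at hi; omega
  have e : (2 * x - 1) ^ m = (2 * x - 1) ^ (m - i) * (2 * x - 1) ^ i := by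
    rw [← pow_add]; congr 1; omega
  simp only [map_mul, map_pow, map_sub, aeval_X, map_ofNat, map_one, zsmul_eq_mul, div_pow, e,
    eq_intCast, map_intCast]
  field_simp

/-- The factor 2x-1 kills every term except i = m; thus R(1/2) sees only the top coefficient, the
one that governs the asymptotics. -/
theorem aeval_half_mobiusPoly (m : ℕ) (Q : ℤ[X]) :
    aeval (1 / 2 : ℝ) (mobiusPoly m Q) = (Q.coeff m : ℝ) / 2 ^ m := by
  rw [mobiusPoly, map_sum, Finset.sum_eq_single m]
  · simp [div_eq_mul_inv]
  · intro i hi hne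
    have : m - i ≠ 0 := by rw [Finset.mem_range] at hi; omega
    simp [map_ofNat, this]
  · intro h
    simp at h

theorem exists_correction_factor (j : ℕ) : ∃ Q : ℤ[X], Q.natDegree ≤ 3 * j ∧
    PowerSeries.coeff j correction = -(X * (3 * X - 1) ^ (2 * j + 3) * Q) := by
  obtain ⟨F, hF⟩ := correction_dvdBelow (j + 1) j (by omega)
  have hF' : PowerSeries.coeff j correction = X * (3 * X - 1) ^ (2 * j + 3) * F := by
    rw [hF]; ring
  refine ⟨-F, ?_, by rw [hF']; ring⟩
  have hne : PowerSeries.coeff j correction ≠ 0 := fun h => by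
    have := correction_coeff_top_neg j
    rw [h] at this
    simp at this
  have hb : (3 * X - 1 : ℤ[X]).natDegree = 1 := by compute_degree!
  have hF0 : F ≠ 0 := right_ne_zero_of_mul (hF' ▸ hne)
  have hb0 : (3 * X - 1 : ℤ[X]) ≠ 0 := fun h => by rw [h] at hb; simp at hb
  -- Degrees add exactly over ℤ, so the cofactor has degree at most (5j+4) - 1 - (2j+3) = 3j.
  have hdeg := correction_degBelow (j + 1) j (by omega)
  rw [hF', natDegree_mul (mul_ne_zero X_ne_zero (pow_ne_zero _ hb0)) hF0,
    natDegree_mul X_ne_zero (pow_ne_zero _ hb0), natDegree_pow, hb, natDegree_X] at hdeg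
  rw [natDegree_neg]
  omega

theorem coeff_top_correction_factor {j : ℕ} {Q : ℤ[X]} (hQ : Q.natDegree ≤ 3 * j)
    (h : PowerSeries.coeff j correction = -(X * (3 * X - 1) ^ (2 * j + 3) * Q)) :
    (PowerSeries.coeff j correction).coeff (5 * j + 4) = -(3 ^ (2 * j + 3) * Q.coeff (3 * j)) := by
  have hb1 : (3 * X - 1 : ℤ[X]).natDegree ≤ 1 := by compute_degree
  have hb : ((3 * X - 1 : ℤ[X]) ^ (2 * j + 3)).natDegree ≤ 2 * j + 3 := by
    simpa using natDegree_pow_le_of_le (2 * j + 3) hb1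
  have hc : ((3 * X - 1 : ℤ[X]) ^ (2 * j + 3)).coeff (2 * j + 3) = 3 ^ (2 * j + 3) := by
    have := coeff_pow_of_natDegree_le (m := 2 * j + 3) hb1
    rw [mul_one] at this
    rw [this]
    simp [coeff_one, coeff_ofNat_mul]
  rw [h, coeff_neg, mul_assoc, show 5 * j + 4 = (2 * j + 3 + 3 * j) + 1 by ring, coeff_X_mul,
    coeff_mul_add_eq_of_natDegree_le hb hQ, hc]

theorem IsBranch.branchTerm_eq {w : ℂ → ℂ} (hw : IsBranch w) {z : ℂ} (hz : z ∈ disc) {j : ℕ}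
    {Q : ℤ[X]} (hQ : Q.natDegree ≤ 3 * j) :
    branchTerm w (-(X * (3 * X - 1) ^ (2 * j + 3) * Q)) z =
      -w z * ((1 + w z) ^ (2 * (j + 1 + 1)) / (-1 + 2 * w z) ^ (5 * (j + 1) - 1)) *
        aeval (w z) (mobiusPoly (3 * j) Q) := by
  have hs := hw.two_mul_sub_one_ne_zero hz
  rw [aeval_mobiusPoly hQ hs, branchTerm, show 5 * (j + 1) - 1 = (2 * j + 4) + 3 * j by omega,
    show -1 + 2 * w z = 2 * w z - 1 by ring]
  have hb : 3 * coord w z - 1 = (1 + w z) / (2 * w z - 1) := by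
    rw [eq_div_iff hs]
    linear_combination 3 * hw.coord_mul hz
  simp only [map_neg, map_mul, map_pow, map_sub, aeval_X, map_ofNat, map_one]
  rw [hb, show w z / (2 * w z - 1) = coord w z from rfl]
  generalize aeval (coord w z) Q = q
  rw [coord, div_pow]
  generalize 1 + w z = h
  generalize 2 * w z - 1 = s at hs
  rw [pow_add s]
  field_simp
  ring

/-! ### The leading constants -/

/-- The negative convention for R₋₃(1/2) offsets the sign of Γ(-1/2) = -2√π. -/
theorem leading_constant_zero :
    (3 : ℝ) ^ ((5 - ((0 : ℕ) : ℝ)) / 2) / 2 ^ (2 * 0 + 3) *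
      (-(2 / 3) ^ 2 / Real.Gamma ((5 * ((0 : ℕ) : ℝ) - 1) / 2)) = √3 / (4 * √Real.pi) := by
  have hG : Real.Gamma (-(1 / 2)) = -2 * √Real.pi := by
    have h := Real.Gamma_add_one (s := -(1 / 2)) (by norm_num)
    rw [show (-(1 / 2) + 1 : ℝ) = 1 / 2 by norm_num, Real.Gamma_one_half_eq] at h
    linarith
  have h3 : (3 : ℝ) ^ ((5 - ((0 : ℕ) : ℝ)) / 2) = 9 * √3 := by
    rw [show (5 - ((0 : ℕ) : ℝ)) / 2 = 2 + 1 / 2 by norm_num, Real.rpow_add (by norm_num),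
      ← Real.sqrt_eq_rpow]
    norm_num
  have hpi : √Real.pi ≠ 0 := by positivity
  rw [h3, show (5 * ((0 : ℕ) : ℝ) - 1) / 2 = -(1 / 2) by norm_num, hG]
  field_simp
  norm_num

theorem leading_constant_succ (j : ℕ) (q : ℝ) :
    (3 : ℝ) ^ ((5 - ((j + 1 : ℕ) : ℝ)) / 2) / 2 ^ (2 * (j + 1) + 3) *
      (q / 2 ^ (3 * j) / Real.Gamma ((5 * ((j + 1 : ℕ) : ℝ) - 1) / 2)) =
    (-1) ^ (j + 1) * (-(3 ^ (2 * j + 3) * q) * (3 / 2 * ((-(1 / (2 * √3))) ^ (5 * j + 4) /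
      Real.Gamma (((5 * j + 4 : ℕ) : ℝ) / 2)))) := by
  have hΓ : (5 * ((j + 1 : ℕ) : ℝ) - 1) / 2 = ((5 * j + 4 : ℕ) : ℝ) / 2 := by push_cast; ring
  have h3 : (3 : ℝ) ^ ((5 - ((j + 1 : ℕ) : ℝ)) / 2) * √3 ^ (5 * j + 4) = 3 ^ (2 * j + 4) := by
    rw [Real.sqrt_eq_rpow, ← Real.rpow_mul_natCast (by norm_num), ← Real.rpow_add (by norm_num),
      ← Real.rpow_natCast]
    congr 1
    push_cast
    ring
  -- The total exponent of -1 is 6j+5, always odd; this sign cancels the minus in front of the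
  -- cofactor.
  have hsign : (-1 : ℝ) ^ (j + 1) * (-(1 / (2 * √3))) ^ (5 * j + 4) =
      -(1 / (2 ^ (5 * j + 4) * √3 ^ (5 * j + 4))) := by
    rw [neg_pow (1 / (2 * √3)), ← mul_assoc, ← pow_add, one_div, inv_pow, mul_pow,
      show j + 1 + (5 * j + 4) = 2 * (3 * j + 2) + 1 by ring, pow_succ, pow_mul]
    norm_num
  have hs : √(3 : ℝ) ^ (5 * j + 4) ≠ 0 := by positivity
  have hr := eq_div_of_mul_eq hs h3
  rw [hΓ, hr]
  have hG : Real.Gamma (((5 * j + 4 : ℕ) : ℝ) / 2) ≠ 0 :=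
    (Real.Gamma_pos_of_pos (by positivity)).ne'
  calc _ = (1 / (2 ^ (5 * j + 4) * √3 ^ (5 * j + 4))) *
        (3 ^ (2 * j + 3) * q * (3 / 2 / Real.Gamma (((5 * j + 4 : ℕ) : ℝ) / 2))) := by
        field_simp
        ring
    _ = -((-1 : ℝ) ^ (j + 1) * (-(1 / (2 * √3))) ^ (5 * j + 4)) *
        (3 ^ (2 * j + 3) * q * (3 / 2 / Real.Gamma (((5 * j + 4 : ℕ) : ℝ) / 2))) := by
        rw [hsign, neg_neg]
    _ = _ := by ring

theorem IsFormalSolution.isEquivalent_zero {A : ℕ → ℂ → ℂ} (hA : IsFormalSolution A)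
    (R : ℕ → ℤ[X]) :
    (fun n : ℕ => taylorCoeff A 0 n) ~[atTop] (fun n : ℕ => ((mainTerm R 0 n : ℝ) : ℂ)) := by
  have h := hA.isBranch.coeffAsymp_self.isEquivalent (by positivity)
  refine (h.congr_left ?_).congr_right ?_
  · refine Eventually.of_forall fun n => ?_
    simp [taylorCoeff, seriesCoeff]
  · refine Eventually.of_forall fun n => ?_
    simp only [mainTerm, valueAtHalf, if_true]
    rw [leading_constant_zero]
    norm_num

theorem IsFormalSolution.isEquivalent_succ {A : ℕ → ℂ → ℂ} (hA : IsFormalSolution A)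
    {R : ℕ → ℤ[X]} {j : ℕ} {Q : ℤ[X]} (hQ : Q.natDegree ≤ 3 * j)
    (hcorr : PowerSeries.coeff j correction = -(X * (3 * X - 1) ^ (2 * j + 3) * Q))
    (hR : R (j + 1) = mobiusPoly (3 * j) Q) :
    (fun n : ℕ => taylorCoeff A (j + 1) n) ~[atTop]
      (fun n : ℕ => ((mainTerm R (j + 1) n : ℝ) : ℂ)) := by
  have hw := hA.isBranch
  have htop := coeff_top_correction_factor hQ hcorr
  have hneg := correction_coeff_top_neg j
  have h := (hw.coeffAsymp_branchTerm (by omega)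
    (correction_degBelow (j + 1) j (by omega))).const_mul ((-1) ^ (j + 1))
  have hG : 0 < Real.Gamma (((5 * j + 4 : ℕ) : ℝ) / 2) := Real.Gamma_pos_of_pos (by positivity)
  set K : ℝ := (-1) ^ (j + 1) * (((PowerSeries.coeff j correction).coeff (5 * j + 4) : ℝ) *
    (3 / 2 * ((-(1 / (2 * √3))) ^ (5 * j + 4) / Real.Gamma (((5 * j + 4 : ℕ) : ℝ) / 2)))) with hK
  -- Nonvanishing of the limit constant turns the limit statement into an asymptotic equivalence; it
  -- rests on `correction_coeff_top_neg`.
  have hK0 : K ≠ 0 := by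
    have h1 : ((PowerSeries.coeff j correction).coeff (5 * j + 4) : ℝ) ≠ 0 := by
      exact_mod_cast hneg.ne
    have h2 : -(1 / (2 * √3)) ≠ 0 := neg_ne_zero.mpr (by positivity)
    have h3 : (-(1 / (2 * √3))) ^ (5 * j + 4) / Real.Gamma (((5 * j + 4 : ℕ) : ℝ) / 2) ≠ 0 :=
      div_ne_zero (pow_ne_zero _ h2) hG.ne'
    exact mul_ne_zero (pow_ne_zero _ (by norm_num)) (mul_ne_zero h1 (mul_ne_zero (by norm_num) h3))
  have hKc : (-1 : ℂ) ^ (j + 1) *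
      ((((PowerSeries.coeff j correction).coeff (5 * j + 4) : ℝ) * (3 / 2 *
        ((-(1 / (2 * √3))) ^ (5 * j + 4) / Real.Gamma (((5 * j + 4 : ℕ) : ℝ) / 2))) : ℝ) : ℂ) =
      (K : ℂ) := by
    rw [hK, Complex.ofReal_mul ((-1) ^ (j + 1))]
    congr 1
    push_cast
    rfl
  rw [hKc] at h
  refine ((h.isEquivalent hK0).congr_left ?_).congr_right ?_
  · refine Eventually.of_forall fun n => ?_
    simp only
    rw [seriesCoeff_const_mul, taylorCoeff, seriesCoeff_congr (g := A (j + 1)), seriesCoeff]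
    intro z hz
    rw [hA.eq_branchSolution hw (j + 1) z hz, branchSolution_succ]
  · refine Eventually.of_forall fun n => ?_
    simp only [mainTerm, valueAtHalf, Nat.succ_ne_zero, if_false]
    rw [hR, aeval_half_mobiusPoly, leading_constant_succ, hK, htop]
    push_cast
    congr 3
    ring_nf

end DegenerateP3

end

theorem mainTheorem7 :
    (∃ A : ℕ → ℂ → ℂ, DegenerateP3.IsFormalSolution A) ∧
    ∀ A : ℕ → ℂ → ℂ, DegenerateP3.IsFormalSolution A →
      ∃ R : ℕ → ℤ[X],
        (∀ k : ℕ, 1 ≤ k → DegenerateP3.IsRPolynomial A k (R k)) ∧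
        ∀ k : ℕ,
          (fun n : ℕ => DegenerateP3.taylorCoeff A k n) ~[atTop]
            (fun n : ℕ => ((DegenerateP3.mainTerm R k n : ℝ) : ℂ)) := by
  open DegenerateP3 in
  refine ⟨?_, fun A hA => ?_⟩
  · obtain ⟨w, hw⟩ := exists_isBranch
    exact ⟨_, hw.isFormalSolution⟩
  choose Q hQdeg hQ using exists_correction_factor
  -- The shift k - 1 appears because coefficient j of `correction` belongs to A_{j+1}. The value at
  -- k = 0 is immaterial: `valueAtHalf` replaces it by the convention.
  refine ⟨fun k => mobiusPoly (3 * (k - 1)) (Q (k - 1)), ?_, ?_⟩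
  · rintro (_ | j) hk
    · omega
    refine ⟨natDegree_mobiusPoly_le _ _, fun z hz => ?_⟩
    rw [hA.eq_branchSolution hA.isBranch (j + 1) z hz, branchSolution_succ, hQ j]
    exact hA.isBranch.branchTerm_eq hz (hQdeg j)
  · rintro (_ | j)
    · exact hA.isEquivalent_zero _
    · exact hA.isEquivalent_succ (hQdeg j) (hQ j) rfl
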